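/- **Theorem 4.5.** Let $n\ge 2$, $m\ge 1$ and $i=n-1$. *Polytope model.* $B^{i,m}$ is the set of patterns $A=(a_{p,q})_{1\le p\le i\le q\le n}$ of non-negative integers whose sum along every Dyck path from $(1,i)$ to $(i,n)$ (steps $(p,q)\to(p,q+1)$ or $(p+1,q)$) is at most $m$; put $a_{p,q}=0$ for other indices. It carries Kus' type $A_n^{(1)}$ crystal structure, with $\mathrm{wt}(A)=m\omega_i-\sum a_{p,q}(\alpha_p+\dots+\alpha_q)$ and the following lowering operators. * $f_i$ adds $1$ to $a_{i,i}$ if $\varphi_i(A)=m-\sum_{j<i}a_{j,i}-\sum_{j\ge i}a_{i,j}\neq0$. * For $\ell>i$, let $p$ be the least index in $[1,i]$ maximizing $\sum_{j\le p}a_{j,\ell-1}+\sum_{j\ge p}a_{j,\ell}$. Then $f_\ell$ replaces $a_{p,\ell-1},a_{p,\ell}$ by $a_{p,\ell-1}-1,a_{p,\ell}+1$ if $\varphi_\ell(A)=\sum_{j\le p}a_{j,\ell-1}-\sum_{j<p}a_{j,\ell}\ne0$. * For $1\le\ell<i$, let $p$ be the largest index in $[i,n]$ maximizing $\sum_{j\le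 p}a_{\ell,j}+\sum_{j\ge p}a_{\ell+1,j}$. Then $f_\ell$ replaces $a_{\ell,p},a_{\ell+1,p}$ by $a_{\ell,p}+1,a_{\ell+1,p}-1$ if $\varphi_\ell(A)=\sum_{j\ge p}a_{\ell+1,j}-\sum_{j>p}a_{\ell,j}\ne0$. * $f_0$ subtracts $1$ from $a_{1,n}$ if $a_{1,n}\ne0$. In all other cases $f_\ell(A)=0$. The raising operators $e_\ell$ are the partial inverses of the $f_\ell$. *Tableau model.* $\mathrm{SSYT}(m\omega_i)$ is the set of semistandard tableaux of shape $(m^i)$ ($i$ rows of length $m$) with entries in $\{1,\dots,n+1\}$, with the usual weight (given by the content). For $1\le j\le n$, read a tableau by rows, left to right, from the bottom row to the top row, and pair each $j+1$ with the nearest unpaired $j$ to its right, as brackets; $f_j$ changes the rightmost unpaired $j$ to $j+1$, and $e_j$ changes the leftmost unpaired $j+1$ to $j$ (the result is $0$ if there is none). Moreover $e_0=\mathrm{pr}^{-1}e_1\mathrm{pr}$ and $f_0=\mathrm{pr}^{-1}f_1\mathrm{pr}$, where $\mathrm{pr}$ is Schützenberger's promotion. Let $T^{(0)}$ be the tableau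 all of whose entries in row $j$ are $j$. Row $s$ of $T\in\mathrm{SSYT}(m\omega_i)$ has entries in $\{s,s+1,s+2\}$; we write $T_s=(T_{s,1},T_{s,2},T_{s,3})$, where $T_{s,t}$ is the multiplicity of $s+t-1$ in row $s$. *Operators and statistics.* For $A\in B^{i,m}$ put $$H(i)^A=f_n^{\,c}\,f_{n-1}^{\,c},\quad c=\sum_{p=1}^{n-1}a_{p,n},\qquad Y(i)^A_\ell=f_\ell^{\,b_\ell}f_{\ell+1}^{\,b_\ell}\cdots f_{n-2}^{\,b_\ell}\,f_{n-1}^{\,a_{\ell,n-1}},\quad b_\ell=a_{\ell,n-1}+a_{\ell,n}$$ for $1\le\ell\le n-1$ (the rightmost operator acts first), $\Omega_1=-a_{1,n-1}$, $\nu_1=1$, and for $2\le k\le n-1$ $$\Omega_k=a_{k-1,n}+(1-\nu_{k-1})\Omega_{k-1}-a_{k,n-1},\qquad \nu_k=\begin{cases}1&\text{if }\Omega_k<0,\\0&\text{if }\Omega_k\ge0.\end{cases}$$ *Claim.* Let $A\in B^{i,m}$. For every $1\le k<n$, $T^{(k)}:=Y(i)^A_k\cdots Y(i)^A_1H(i)^A(T^{(0)})$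 is an element of $\mathrm{SSYT}(m\omega_i)$ (that is, it is not $0$), and its rows are as follows. * For $1\le s\le k-1$, $$T^{(k)}_s=\Big(m-\sum_{j=1}^s(a_{j,n}-\nu_j\Omega_j),\ -\sum_{j=1}^s\nu_j\Omega_j+(1-\nu_{s+1})\Omega_{s+1},\ \sum_{j=2}^{s+1}(a_{j,n-1}+\nu_j\Omega_j)\Big).$$ * For $k\le s\le i-1$, $$T^{(k)}_s=\Big(m-\sum_{j=1}^k(a_{j,n}-\nu_j\Omega_j),\ -\sum_{j=1}^k\nu_j\Omega_j+a_{k,n}+(1-\nu_k)\Omega_k,\ \sum_{j=2}^{k}(a_{j,n-1}+\nu_j\Omega_j)\Big).$$ * For $s=i$, $$T^{(k)}_i=\Big(m-\sum_{j=1}^i a_{j,n}+\sum_{j=1}^k\nu_j\Omega_j,\ -\sum_{j=1}^k\nu_j\Omega_j,\ \sum_{j=1}^i a_{j,n}\Big).$$ In particular, if $\varphi_{i,m}:B^{i,m}\to\mathrm{SSYT}(m\omega_i)$ is the affine crystal isomorphism (a bijection preserving weights and commuting with $e_\ell,f_\ell$ for all $0\le\ell\le n$), then $\varphi_{i,m}(A)=T^{(n-1)}$.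 -/

import Mathlib

open Finset

namespace KRCrystal

/-! ## Crystals and their isomorphisms

Nodes of the affine Dynkin diagram `A_n^{(1)}` are the natural numbers `0, 1, …, n`.  An operator
with values in `𝓑 ∪ {0}` is a map to `Option`, where `none` is the extra element `0`. -/

/-- The data of a (seminormal) `A_n^{(1)}`-crystal: `wt x ℓ` is the value of the weight of `x` on
the coroot `α_ℓ^∨`, and `e ℓ`, `f ℓ` are the raising and lowering operators. The functions `ε_ℓ`
and `φ_ℓ` of a seminormal crystal are determined by the operators. -/
structure CrystalData (X : Type*) where
  wt : X → ℕ → ℤ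
  e : ℕ → X → Option X
  f : ℕ → X → Option X

/-- An isomorphism of affine crystals: a bijection which preserves the weight and commutes with all
`e_ℓ`, `f_ℓ` for `ℓ = 0, …, n` (`0` being sent to `0`). -/
structure IsAffineCrystalIso {X Y : Type*} (n : ℕ) (C : CrystalData X) (D : CrystalData Y)
    (φ : X ≃ Y) : Prop where
  map_wt : ∀ ℓ ≤ n, ∀ x, D.wt (φ x) ℓ = C.wt x ℓ
  map_e : ∀ ℓ ≤ n, ∀ x, D.e ℓ (φ x) = (C.e ℓ x).map φ
  map_f : ∀ ℓ ≤ n, ∀ x, D.f ℓ (φ x) = (C.f ℓ x).map φ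

/-- The operator on `X` induced by an operator `g` on `Y` along an injection `ι : X → Y`: its value
at `x` is the element `y` of `X` with `ι y = g (ι x)`, and `0` if `g (ι x) = 0`.
(In all uses below `g (ι x)` is either `0` or in the image of `ι`.) -/
noncomputable def induced {X Y : Type*} (ι : X → Y) (g : Y → Option Y) (x : X) : Option X :=
  open Classical in
  if h : ∃ y, g (ι x) = some (ι y) then some h.choose else none

/-- The value of a level zero weight on all the coroots `α_0^∨, …, α_n^∨`, from its values on
`α_1^∨, …, α_n^∨` (the canonical central element is `α_0^∨ + ⋯ + α_n^∨`). -/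
def levelZero (n : ℕ) (w : ℕ → ℤ) (ℓ : ℕ) : ℤ :=
  if ℓ = 0 then - ∑ j ∈ Icc 1 n, w j else w ℓ

/-- `powOp g a` is the `a`-th power of the operator `g`, where `g 0 = 0`. -/
def powOp {X : Type*} (g : X → Option X) (a : ℕ) : Option X → Option X :=
  (fun o => o.bind g)^[a]

/-- For `L = [(j₁, a₁), …, (j_r, a_r)]`, the ordered product `g_{j₁}^{a₁} ⋯ g_{j_r}^{a_r}`. As usual
for a composition, the rightmost factor acts first. -/
def prodOp {X : Type*} (g : ℕ → X → Option X) (L : List (ℕ × ℕ)) (o : Option X) : Option X :=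
  L.foldr (fun ja o' => powOp (g ja.1) ja.2 o') o

/-! ## The polytope model -/

/-- Dyck paths: sequences `β(1), …, β(n)` from `(1, i)` to `(i, n)` such that each step
increases one of the two coordinates by one. -/
def IsDyckPath (n i : ℕ) (β : ℕ → ℕ × ℕ) : Prop :=
  β 1 = (1, i) ∧ β n = (i, n) ∧
    ∀ r, 1 ≤ r → r < n → β (r + 1) = ((β r).1, (β r).2 + 1) ∨ β (r + 1) = ((β r).1 + 1, (β r).2)

/-- The integral points of the polytope: patterns `(a_{p,q})` of non-negative integers,
`1 ≤ p ≤ i ≤ q ≤ n`, with all sums along Dyck paths at most `m`. By convention `a_{p,q} = 0` for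
indices out of this range. -/
structure IsPolytopePoint (n i m : ℕ) (a : ℕ → ℕ → ℕ) : Prop where
  support : ∀ p q, ¬ (1 ≤ p ∧ p ≤ i ∧ i ≤ q ∧ q ≤ n) → a p q = 0
  dyck : ∀ β, IsDyckPath n i β → ∑ r ∈ Icc 1 n, a (β r).1 (β r).2 ≤ m

/-- The set `B^{i,m}_n`. -/
abbrev Polytope (n i m : ℕ) : Type := {a : ℕ → ℕ → ℕ // IsPolytopePoint n i m a}

/-- The entries of a pattern after adding one to `a_{p,q}`. -/
def incr (p q : ℕ) (a : ℕ → ℕ → ℕ) : ℕ → ℕ → ℕ :=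
  fun p' q' => if p' = p ∧ q' = q then a p q + 1 else a p' q'

/-- The entries of a pattern after subtracting one from `a_{p,q}` (only used if `a_{p,q} > 0`). -/
def decr (p q : ℕ) (a : ℕ → ℕ → ℕ) : ℕ → ℕ → ℕ :=
  fun p' q' => if p' = p ∧ q' = q then a p q - 1 else a p' q'

/-- The least element of `s` at which `S` attains its maximum over `s`. -/
def firstMax (s : Finset ℕ) (S : ℕ → ℕ) : ℕ :=
  (s.filter fun p => ∀ q ∈ s, S q ≤ S p).min.untopD 0

/-- The largest element of `s` at which `S` attains its maximum over `s`. -/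
def lastMax (s : Finset ℕ) (S : ℕ → ℕ) : ℕ :=
  (s.filter fun p => ∀ q ∈ s, S q ≤ S p).max.unbotD 0

/-- The step sums for `ℓ > i`. -/
def stepPlus (i ℓ : ℕ) (a : ℕ → ℕ → ℕ) (p : ℕ) : ℕ :=
  ∑ j ∈ Icc 1 p, a j (ℓ - 1) + ∑ j ∈ Icc p i, a j ℓ

/-- The step sums for `ℓ < i`. -/
def stepMinus (n i ℓ : ℕ) (a : ℕ → ℕ → ℕ) (p : ℕ) : ℕ :=
  ∑ j ∈ Icc i p, a ℓ j + ∑ j ∈ Icc p n, a (ℓ + 1) j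

def pPlus (i ℓ : ℕ) (a : ℕ → ℕ → ℕ) : ℕ := firstMax (Icc 1 i) (stepPlus i ℓ a)

def qPlus (i ℓ : ℕ) (a : ℕ → ℕ → ℕ) : ℕ := lastMax (Icc 1 i) (stepPlus i ℓ a)

def pMinus (n i ℓ : ℕ) (a : ℕ → ℕ → ℕ) : ℕ := lastMax (Icc i n) (stepMinus n i ℓ a)

def qMinus (n i ℓ : ℕ) (a : ℕ → ℕ → ℕ) : ℕ := firstMax (Icc i n) (stepMinus n i ℓ a)

/-- The functions `φ_ℓ` on the polytope, `0 ≤ ℓ ≤ n`. -/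
def polyPhi (n i m ℓ : ℕ) (a : ℕ → ℕ → ℕ) : ℤ :=
  if ℓ = 0 then (a 1 n : ℤ)
  else if ℓ = i then (m : ℤ) - ∑ j ∈ Icc 1 (i - 1), (a j i : ℤ) - ∑ j ∈ Icc i n, (a i j : ℤ)
  else if i < ℓ then
    ∑ j ∈ Icc 1 (pPlus i ℓ a), (a j (ℓ - 1) : ℤ) - ∑ j ∈ Icc 1 (pPlus i ℓ a - 1), (a j ℓ : ℤ)
  else
    ∑ j ∈ Icc (pMinus n i ℓ a) n, (a (ℓ + 1) j : ℤ)
      - ∑ j ∈ Icc (pMinus n i ℓ a + 1) n, (a ℓ j : ℤ)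

/-- The functions `ε_ℓ` on the polytope, `0 ≤ ℓ ≤ n`. -/
def polyEps (n i m ℓ : ℕ) (a : ℕ → ℕ → ℕ) : ℤ :=
  if ℓ = 0 then (m : ℤ) - ∑ j ∈ Icc i n, (a 1 j : ℤ) - ∑ j ∈ Icc 2 i, (a j n : ℤ)
  else if ℓ = i then (a i i : ℤ)
  else if i < ℓ then
    ∑ j ∈ Icc (qPlus i ℓ a) i, (a j ℓ : ℤ) - ∑ j ∈ Icc (qPlus i ℓ a + 1) i, (a j (ℓ - 1) : ℤ)
  else
    ∑ j ∈ Icc i (qMinus n i ℓ a), (a ℓ j : ℤ)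
      - ∑ j ∈ Icc i (qMinus n i ℓ a - 1), (a (ℓ + 1) j : ℤ)

/-- The lowering operators on patterns, `0 ≤ ℓ ≤ n`. -/
def polyF (n i m ℓ : ℕ) (a : ℕ → ℕ → ℕ) : Option (ℕ → ℕ → ℕ) :=
  if polyPhi n i m ℓ a = 0 then none
  else if ℓ = 0 then some (decr 1 n a)
  else if ℓ = i then some (incr i i a)
  else if i < ℓ then some (incr (pPlus i ℓ a) ℓ (decr (pPlus i ℓ a) (ℓ - 1) a))
  else some (incr ℓ (pMinus n i ℓ a) (decr (ℓ + 1) (pMinus n i ℓ a) a))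

/-- The raising operators on patterns, `0 ≤ ℓ ≤ n`. -/
def polyE (n i m ℓ : ℕ) (a : ℕ → ℕ → ℕ) : Option (ℕ → ℕ → ℕ) :=
  if polyEps n i m ℓ a = 0 then none
  else if ℓ = 0 then some (incr 1 n a)
  else if ℓ = i then some (decr i i a)
  else if i < ℓ then some (incr (qPlus i ℓ a) (ℓ - 1) (decr (qPlus i ℓ a) ℓ a))
  else some (incr (ℓ + 1) (qMinus n i ℓ a) (decr ℓ (qMinus n i ℓ a) a))

/-- Entries of the Cartan matrix of type `A`. -/
def cartan (r ℓ : ℕ) : ℤ := if r = ℓ then 2 else if r = ℓ + 1 ∨ ℓ = r + 1 then -1 else 0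

/-- The value on `α_ℓ^∨` (for `1 ≤ ℓ ≤ n`) of the weight `m ω_i - ∑ a_{p,q} α_{p,q}`, where
`α_{p,q} = α_p + ⋯ + α_q`. -/
def polyWt (n i m : ℕ) (a : ℕ → ℕ → ℕ) (ℓ : ℕ) : ℤ :=
  (if ℓ = i then (m : ℤ) else 0)
    - ∑ p ∈ Icc 1 i, ∑ q ∈ Icc i n, (a p q : ℤ) * ∑ r ∈ Icc p q, cartan r ℓ

/-- The affine crystal `B^{i,m}`. -/
noncomputable def polytopeCrystal (n i m : ℕ) : CrystalData (Polytope n i m) where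
  wt A := levelZero n (polyWt n i m A.1)
  e ℓ := induced Subtype.val (polyE n i m ℓ)
  f ℓ := induced Subtype.val (polyF n i m ℓ)

/-! ## The signature rule on words -/

/-- The number of letters `j+1` of `w` which stay unpaired when each `j+1` is paired with the
nearest unpaired `j` to its right (`j+1` and `j` play the role of opening and closing brackets). -/
def unpairedUpper (j : ℕ) (w : List ℕ) : ℕ :=
  w.foldl (fun c x => if x = j + 1 then c + 1 else if x = j then c - 1 else c) 0

/-- The number of letters `j` of `w` which stay unpaired. -/
def unpairedLower (j : ℕ) (w : List ℕ) : ℕ :=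
  w.foldr (fun x c => if x = j then c + 1 else if x = j + 1 then c - 1 else c) 0

/-- Changes the rightmost unpaired `j` of `w` to `j+1`. A letter `j` is unpaired if no unpaired
`j+1` is left among the letters before it. -/
def wordF (j : ℕ) (w : List ℕ) : Option (List ℕ) :=
  ((List.range w.length).filter fun k =>
    w[k]? = some j ∧ unpairedUpper j (w.take k) = 0).getLast?.map fun k => w.set k (j + 1)

/-- Changes the leftmost unpaired `j+1` of `w` to `j`. A letter `j+1` is unpaired if no unpaired
`j` is left among the letters after it. -/
def wordE (j : ℕ) (w : List ℕ) : Option (List ℕ) :=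
  ((List.range w.length).filter fun k =>
    w[k]? = some (j + 1) ∧ unpairedLower j (w.drop (k + 1)) = 0).head?.map fun k => w.set k j

/-! ## The tableau model

As in Mathlib, rows and columns of a tableau are indexed from `0`; its entries are
`1, …, n+1`. -/

/-- The rectangular shape `(m^i)`: `i` rows of length `m`. -/
def rect (i m : ℕ) : YoungDiagram where
  cells := range i ×ˢ range m
  isLowerSet := by
    rintro ⟨a, b⟩ ⟨c, d⟩ ⟨h₁, h₂⟩ h
    simp only [coe_product, coe_range, Set.mem_prod, Set.mem_Iio] at h h₁ h₂ ⊢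
    omega

/-- The set `SSYT(m ω_i)`: semistandard tableaux of shape `(m^i)` with entries in `[n+1]`. -/
abbrev Tableau (n i m : ℕ) : Type :=
  {T : SemistandardYoungTableau (rect i m) // ∀ r < i, ∀ c < m, 1 ≤ T r c ∧ T r c ≤ n + 1}

/-- The word of a filling of the rectangle `(m^i)`: rows are read from left to right, beginning
with the bottom row and moving upward. -/
def readingWord (i m : ℕ) (F : ℕ → ℕ → ℕ) : List ℕ :=
  (List.range i).reverse.flatMap fun r => (List.range m).map fun c => F r c

/-- The entries of a filling after replacing the entry at `(r, c)` by `v`. -/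
def setEntry (F : ℕ → ℕ → ℕ) (r c v : ℕ) : ℕ → ℕ → ℕ :=
  fun r' c' => if r' = r ∧ c' = c then v else F r' c'

/-- Jeu de taquin: slides the empty box `(r, c)` to the upper left until it has no nonempty
neighbour on its left or above it. In each step the larger of these two neighbours moves into the
empty box, and the one above in case of equality. Empty boxes carry the entry `0`. -/
def slide (F : ℕ → ℕ → ℕ) (r c : ℕ) : ℕ → ℕ → ℕ :=
  if 0 < r ∧ 0 < F (r - 1) c ∧ (c = 0 ∨ F r (c - 1) ≤ F (r - 1) c) then
    slide (setEntry F r c (F (r - 1) c)) (r - 1) c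
  else if 0 < c ∧ 0 < F r (c - 1) then
    slide (setEntry F r c (F r (c - 1))) r (c - 1)
  else setEntry F r c 0
termination_by r + c

/-- Schützenberger's promotion operator on tableaux of shape `(m^i)` with entries in `[n+1]`:
remove the entries `n+1` (all in the last row), slide the resulting empty boxes one after the
other, from left to right, to the upper left, fill the empty boxes with `0` and increase all entries
by one. -/
def promotion (n i m : ℕ) (T : ℕ → ℕ → ℕ) : ℕ → ℕ → ℕ :=
  let F := ((List.range m).filter fun c => T (i - 1) c = n + 1).foldl
    (fun F c => slide F (i - 1) c) (fun r c => if T r c = n + 1 then 0 else T r c)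
  fun r c => if r < i ∧ c < m then F r c + 1 else 0

/-- The word of a tableau. -/
def Tableau.word {n i m : ℕ} (T : Tableau n i m) : List ℕ := readingWord i m T.1

/-- The word of the promotion of a tableau. -/
def Tableau.promotionWord {n i m : ℕ} (T : Tableau n i m) : List ℕ :=
  readingWord i m (promotion n i m T.1)

/-- The affine crystal `SSYT(m ω_i)`. For `j ≥ 1` the operators are given by the signature rule;
`e_0 = pr⁻¹ ∘ e_1 ∘ pr` and `f_0 = pr⁻¹ ∘ f_1 ∘ pr`, that is, `f_0 T` is the tableau whose promotion
is `f_1 (pr T)`. -/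
noncomputable def tableauCrystal (n i m : ℕ) : CrystalData (Tableau n i m) where
  wt T := levelZero n fun ℓ => (T.word.count ℓ : ℤ) - T.word.count (ℓ + 1)
  e ℓ := if ℓ = 0 then induced Tableau.promotionWord (wordE 1) else induced Tableau.word (wordE ℓ)
  f ℓ := if ℓ = 0 then induced Tableau.promotionWord (wordF 1) else induced Tableau.word (wordF ℓ)

/-- The highest weight tableau `T^{(0)}`: all entries of the `j`-th row are `j`. -/
def highestTableau (n i m : ℕ) (h : i ≤ n) : Tableau n i m :=
  ⟨{ entry := fun r c => if r < i ∧ c < m then r + 1 else 0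
     row_weak' := by
      intro r c₁ c₂ hc hr
      have hr' : r < i ∧ c₂ < m := by
        simpa [rect, ← YoungDiagram.mem_cells] using hr
      rw [if_pos hr', if_pos ⟨hr'.1, hc.trans hr'.2⟩]
     col_strict' := by
      intro r₁ r₂ c hr hc
      have hc' : r₂ < i ∧ c < m := by
        simpa [rect, ← YoungDiagram.mem_cells] using hc
      rw [if_pos hc', if_pos ⟨hr.trans hc'.1, hc'.2⟩]
      omega
     zeros' := by
      intro r c hrc
      have hrc' : ¬ (r < i ∧ c < m) := by
        simpa [rect, ← YoungDiagram.mem_cells] using hrc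
      exact if_neg hrc' },
   by
    intro r hr c hc
    change 1 ≤ (if r < i ∧ c < m then r + 1 else 0) ∧ (if r < i ∧ c < m then r + 1 else 0) ≤ n + 1
    rw [if_pos ⟨hr, hc⟩]
    omega⟩

/-- `T.mult s t` is the multiplicity `T_{s,t}` of the entry `s+t-1` in the `s`-th row of `T`, where
rows are numbered from `1`. -/
def Tableau.mult {n i m : ℕ} (T : Tableau n i m) (s t : ℕ) : ℕ :=
  #{c ∈ range m | T.1 (s - 1) c = s + t - 1}

/-- The tuple `(T_{s,1}, T_{s,2}, T_{s,3})`. -/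
def Tableau.rowTriple {n i m : ℕ} (T : Tableau n i m) (s : ℕ) : ℤ × ℤ × ℤ :=
  (T.mult s 1, T.mult s 2, T.mult s 3)

/-! ## The operators `H(i)^A`, `Y(i)_ℓ^A`, the tableaux `T^{(k)}` and the statistics -/

/-- `H(i)^A = ∏_{j=i}^{n} f_{n+i-j}^{∑_{p=1}^{i} a_{p,n}}`. -/
def opH (n i : ℕ) (a : ℕ → ℕ → ℕ) : List (ℕ × ℕ) :=
  (List.Ico i (n + 1)).map fun j => (n + i - j, ∑ p ∈ Icc 1 i, a p n)

/-- `Y(i)_ℓ^A = (∏_{j=ℓ}^{i-1} f_j^{∑_{p=i}^{n} a_{ℓ,p}})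
(∏_{j=i}^{n-1} f_{n-1+i-j}^{∑_{p=n-1+i-j}^{n-1} a_{ℓ,p}})`. -/
def opY (n i : ℕ) (a : ℕ → ℕ → ℕ) (ℓ : ℕ) : List (ℕ × ℕ) :=
  ((List.Ico ℓ i).map fun j => (j, ∑ p ∈ Icc i n, a ℓ p)) ++
    (List.Ico i n).map fun j => (n - 1 + i - j, ∑ p ∈ Icc (n - 1 + i - j) (n - 1), a ℓ p)

/-- The image `T^{(k)} = Y(i)_k^A ⋯ Y(i)_1^A H(i)^A (T^{(0)})` in `SSYT(m ω_i) ∪ {0}`. -/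
noncomputable def tableauSeq (n i m : ℕ) (h : i ≤ n) (a : ℕ → ℕ → ℕ) : ℕ → Option (Tableau n i m)
  | 0 => prodOp (tableauCrystal n i m).f (opH n i a) (some (highestTableau n i m h))
  | k + 1 => prodOp (tableauCrystal n i m).f (opY n i a (k + 1)) (tableauSeq n i m h a k)

/-- The pair `(Ω_k, ν_k)`, `k ≥ 1` (the value at `k = 0` is not used). -/
def omegaNu (n : ℕ) (a : ℕ → ℕ → ℕ) : ℕ → ℤ × ℤ
  | 0 => (0, 0)
  | 1 => (-(a 1 (n - 1) : ℤ), 1)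
  | k + 2 =>
    let Ω : ℤ := (a (k + 1) n : ℤ)
      + (1 - (omegaNu n a (k + 1)).2) * (omegaNu n a (k + 1)).1 - (a (k + 2) (n - 1) : ℤ)
    (Ω, if Ω < 0 then 1 else 0)

def Omega (n : ℕ) (a : ℕ → ℕ → ℕ) (k : ℕ) : ℤ := (omegaNu n a k).1

def nu (n : ℕ) (a : ℕ → ℕ → ℕ) (k : ℕ) : ℤ := (omegaNu n a k).2

end KRCrystal

open KRCrystal

/-!
The tableau side is a direct computation.  A semistandard tableau with `n-1` rows of length `m` and
entries in `1, …, n+1` is the same as a pair of antitone sequences `x ≤ y` (`IsProfile`), where row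
`s` consists of `x s` entries `s`, of `y s - x s` entries `s+1`, and of `m - y s` entries `s+2`.
The signature rule becomes local: by `Reaches.powOp_f`, `f_j` changes an entry `j` of row `j-1` as
long as that row has more entries `j` than row `j` has entries `j+1`, and afterwards it changes
entries `j` of row `j`.  The first power in `Y(i)_k`, that of `f_{n-1}`, is therefore split into two
parts: `min (a_{k,n-1}) (Ω_k + a_{k,n-1}) = a_{k,n-1} + ν_k Ω_k` steps in row `n-2` and `-ν_k Ω_k`
steps in row `n-1`.  Since rows `k-1, …, n-2` agree before `Y(i)_k` acts, each of the remaining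
factors `f_j` splits its exponent in the same way (`Reaches.prodOp_sweep`), and `T^{(k)}` is found by
induction (`exists_reaches_tableauSeq`).  The tableaux never become `0` because the partial sums of
`-ν_j Ω_j` are running maxima of differences that are bounded by the Dyck path inequalities
(`IsPolytopePoint.neg_sum_nu_mul_Omega_le`).

For the statement on the isomorphism `φ`, weights show that `φ` sends the zero pattern to the highest
weight tableau (`map_zeroPattern`).  So `T^{(n-1)}` is the image under `φ` of the same product of
operators applied to the zero pattern.  The latter is not `0`, because `T^{(n-1)}` is not, and thus
it suffices to follow the pattern as long as it is nonzero: `H(i)` creates the sum of column `n` in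
row `n-1`, and `Y(i)_k` builds row `k` of `A` from it (`tracks_opY`), so the result is `A`
(`tracks_polytopeSeq`).
-/

namespace KRCrystal

/-! ### Powers and products of operators -/

section Operators

variable {X Y : Type*}

theorem induced_eq_some {ι : X → Y} (hι : Function.Injective ι) {g : Y → Option Y} {x y : X}
    (h : g (ι x) = some (ι y)) : induced ι g x = some y := by
  have hex : ∃ y, g (ι x) = some (ι y) := ⟨y, h⟩
  rw [induced, dif_pos hex]
  exact congrArg some (hι (Option.some.inj (hex.choose_spec.symm.trans h)))

theorem of_induced_eq_some {ι : X → Y} {g : Y → Option Y} {x y : X}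
    (h : induced ι g x = some y) : g (ι x) = some (ι y) := by
  unfold induced at h
  split_ifs at h with hex
  rw [← Option.some.inj h]
  exact hex.choose_spec

theorem powOp_zero (g : X → Option X) (o : Option X) : powOp g 0 o = o := rfl

theorem powOp_succ (g : X → Option X) (a : ℕ) (o : Option X) :
    powOp g (a + 1) o = (powOp g a o).bind g := by
  simp only [powOp, Function.iterate_succ_apply']

theorem powOp_add (g : X → Option X) (a b : ℕ) (o : Option X) :
    powOp g (a + b) o = powOp g b (powOp g a o) := by
  simp only [powOp, Nat.add_comm a b, Function.iterate_add_apply]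

theorem prodOp_nil (g : ℕ → X → Option X) (o : Option X) : prodOp g [] o = o := rfl

theorem prodOp_cons (g : ℕ → X → Option X) (j a : ℕ) (L : List (ℕ × ℕ)) (o : Option X) :
    prodOp g ((j, a) :: L) o = powOp (g j) a (prodOp g L o) := rfl

theorem prodOp_append (g : ℕ → X → Option X) (L M : List (ℕ × ℕ)) (o : Option X) :
    prodOp g (L ++ M) o = prodOp g L (prodOp g M o) := by
  simp [prodOp, List.foldr_append]

theorem powOp_map {g : X → Option X} {h : Y → Option Y} {φ : X → Y}
    (H : ∀ x, h (φ x) = (g x).map φ) (a : ℕ) (o : Option X) :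
    powOp h a (o.map φ) = (powOp g a o).map φ := by
  induction a with
  | zero => rfl
  | succ a ih =>
    rw [powOp_succ, powOp_succ, ih]
    cases powOp g a o with
    | none => rfl
    | some x => exact H x

theorem prodOp_map {g : ℕ → X → Option X} {h : ℕ → Y → Option Y} {φ : X → Y}
    (L : List (ℕ × ℕ)) (H : ∀ ja ∈ L, ∀ x, h ja.1 (φ x) = (g ja.1 x).map φ) (o : Option X) :
    prodOp h L (o.map φ) = (prodOp g L o).map φ := by
  induction L with
  | nil => rfl
  | cons ja L ih =>
    obtain ⟨j, a⟩ := ja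
    rw [prodOp_cons, prodOp_cons, ih fun ja hja => H ja (List.mem_cons_of_mem _ hja)]
    exact powOp_map (H (j, a) List.mem_cons_self) a _

end Operators

/-! ### The signature rule on words -/

section Words

variable {j : ℕ}

/-- The number of unpaired `j+1` after reading the word `w`, when `c` of them were there before. -/
def openAfter (j c : ℕ) (w : List ℕ) : ℕ :=
  w.foldl (fun c x => if x = j + 1 then c + 1 else if x = j then c - 1 else c) c

/-- With `c` unpaired letters `j+1` in front of the word `w`, every letter `j` of `w` is paired. -/
def AllPaired (j : ℕ) : ℕ → List ℕ → Prop
  | _, [] => True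
  | c, x :: w =>
    if x = j + 1 then AllPaired j (c + 1) w
    else if x = j then 0 < c ∧ AllPaired j (c - 1) w
    else AllPaired j c w

theorem openAfter_append (c : ℕ) (u v : List ℕ) :
    openAfter j c (u ++ v) = openAfter j (openAfter j c u) v := List.foldl_append

theorem allPaired_append (c : ℕ) (u v : List ℕ) :
    AllPaired j c (u ++ v) ↔ AllPaired j c u ∧ AllPaired j (openAfter j c u) v := by
  induction u generalizing c with
  | nil => simp [AllPaired, openAfter]
  | cons x u ih =>
    simp only [List.cons_append, AllPaired, openAfter, List.foldl_cons]
    split_ifs <;> simp [ih, openAfter, and_assoc]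

theorem openAfter_of_forall_ne (c : ℕ) {w : List ℕ} (h : ∀ x ∈ w, x ≠ j ∧ x ≠ j + 1) :
    openAfter j c w = c := by
  induction w with
  | nil => rfl
  | cons x w ih =>
    have hx := h x List.mem_cons_self
    simp only [openAfter, List.foldl_cons, if_neg hx.1, if_neg hx.2]
    exact ih fun y hy => h y (List.mem_cons_of_mem _ hy)

theorem allPaired_of_forall_ne (c : ℕ) {w : List ℕ} (h : ∀ x ∈ w, x ≠ j) :
    AllPaired j c w := by
  induction w generalizing c with
  | nil => trivial
  | cons x w ih =>
    have ih' := fun c => ih c fun y hy => h y (List.mem_cons_of_mem _ hy)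
    have hx := h x List.mem_cons_self
    simp only [AllPaired, if_neg hx]
    split_ifs <;> exact ih' _

theorem openAfter_replicate_upper (c p : ℕ) :
    openAfter j c (List.replicate p (j + 1)) = c + p := by
  induction p generalizing c with
  | zero => rfl
  | succ p ih =>
    simp only [openAfter, List.replicate_succ, List.foldl_cons, if_true] at ih ⊢
    rw [ih]; omega

theorem openAfter_replicate_lower (c p : ℕ) :
    openAfter j c (List.replicate p j) = c - p := by
  induction p generalizing c with
  | zero => rfl
  | succ p ih =>
    simp only [openAfter, List.replicate_succ, List.foldl_cons, if_true] at ih ⊢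
    rw [if_neg (by omega), ih]; omega

theorem allPaired_replicate_lower (c p : ℕ) :
    AllPaired j c (List.replicate p j) ↔ p ≤ c := by
  induction p generalizing c with
  | zero => simp [AllPaired]
  | succ p ih =>
    simp only [AllPaired, List.replicate_succ, if_true, ih]
    rw [if_neg (by omega)]; omega

/-- `AllPaired` in terms of the condition by which `wordF` selects unpaired letters. -/
theorem AllPaired.openAfter_take_ne_zero {c : ℕ} {w : List ℕ} (h : AllPaired j c w) {k : ℕ}
    (hk : w[k]? = some j) : openAfter j c (w.take k) ≠ 0 := by
  induction w generalizing c k with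
  | nil => simp at hk
  | cons x w ih =>
    cases k with
    | zero =>
      simp only [List.getElem?_cons_zero, Option.some.injEq] at hk
      subst hk
      simp only [AllPaired, if_true] at h
      rw [if_neg (by omega)] at h
      simpa [openAfter] using h.1.ne'
    | succ k =>
      simp only [List.getElem?_cons_succ] at hk
      simp only [AllPaired] at h
      simp only [List.take_succ_cons, openAfter, List.foldl_cons]
      split_ifs at h ⊢
      · exact ih h hk
      · exact ih h.2 hk
      · exact ih h hk

/-- The signature rule changes the letter `j` of `u j v` when it is unpaired and every `j` of `v` is
paired. -/
theorem wordF_append_cons {u v : List ℕ} (hu : openAfter j 0 u = 0) (hv : AllPaired j 0 v) :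
    wordF j (u ++ j :: v) = some (u ++ (j + 1) :: v) := by
  have hlast : ((List.range (u ++ j :: v).length).filter fun k =>
      (u ++ j :: v)[k]? = some j ∧ unpairedUpper j ((u ++ j :: v).take k) = 0).getLast?
        = some u.length := by
    have hlen : (u ++ j :: v).length = u.length + 1 + v.length := by
      simp only [List.length_append, List.length_cons]; omega
    rw [hlen, List.range_add, List.range_succ, List.filter_append, List.filter_append]
    have htail : ((List.range v.length).map (u.length + 1 + ·)).filter (fun k =>
        decide ((u ++ j :: v)[k]? = some j ∧ unpairedUpper j ((u ++ j :: v).take k) = 0)) = [] := by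
      rw [List.filter_eq_nil_iff]
      intro k hk
      obtain ⟨l, -, rfl⟩ := List.mem_map.1 hk
      have e₁ : (u ++ j :: v)[u.length + 1 + l]? = v[l]? := by
        rw [List.getElem?_append_right (by omega),
          show u.length + 1 + l - u.length = l + 1 by omega, List.getElem?_cons_succ]
      have e₂ : (u ++ j :: v).take (u.length + 1 + l) = u ++ j :: v.take l := by
        rw [show u.length + 1 + l = u.length + (l + 1) by omega, List.take_length_add_append,
          List.take_succ_cons]
      rw [decide_eq_true_iff, e₁, e₂]
      rintro ⟨hl, h0⟩
      refine hv.openAfter_take_ne_zero hl ?_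
      change openAfter j 0 _ = 0 at h0
      rw [openAfter_append, hu] at h0
      simpa [openAfter] using h0
    have hone : ([u.length]).filter (fun k =>
        decide ((u ++ j :: v)[k]? = some j ∧ unpairedUpper j ((u ++ j :: v).take k) = 0))
        = [u.length] := by
      rw [List.filter_cons_of_pos, List.filter_nil]
      rw [decide_eq_true_iff]
      refine ⟨by simp, ?_⟩
      rw [List.take_left]
      exact hu
    rw [htail, hone, List.append_nil, List.getLast?_concat]
  rw [wordF, hlast]
  simp

end Words

/-! ### Row words stacked into reading words -/

section Stacking

variable {row row' : ℕ → List ℕ} {n : ℕ}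

/-- The rows `n-1, …, s` read one after the other. -/
def upperRows (n : ℕ) (row : ℕ → List ℕ) (s : ℕ) : List ℕ :=
  (List.range' s (n - s)).reverse.flatMap row

/-- The rows `s, …, 1` read one after the other. -/
def lowerRows (row : ℕ → List ℕ) (s : ℕ) : List ℕ := (List.range' 1 s).reverse.flatMap row

theorem upperRows_of_le {s : ℕ} (h : n ≤ s) : upperRows n row s = [] := by
  simp [upperRows, Nat.sub_eq_zero_of_le h]

theorem upperRows_of_lt {s : ℕ} (h : s < n) :
    upperRows n row s = upperRows n row (s + 1) ++ row s := by
  obtain ⟨d, rfl⟩ := Nat.exists_eq_add_of_lt h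
  simp [upperRows, show s + d + 1 - s = d + 1 by omega, show s + d + 1 - (s + 1) = d by omega,
    List.range'_succ]

theorem lowerRows_succ (s : ℕ) : lowerRows row (s + 1) = row (s + 1) ++ lowerRows row s := by
  simp [lowerRows, List.range'_1_concat, Nat.add_comm 1 s]

theorem upperRows_append_lowerRows {s : ℕ} (h : s < n) :
    upperRows n row (s + 1) ++ lowerRows row s = upperRows n row 1 := by
  induction s with
  | zero => simp [lowerRows]
  | succ s ih =>
    rw [← ih (by omega), upperRows_of_lt h, lowerRows_succ, List.append_assoc]

theorem upperRows_congr {s : ℕ} (h : ∀ t, s ≤ t → row t = row' t) :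
    upperRows n row s = upperRows n row' s := by
  unfold upperRows
  refine List.flatMap_congr fun t ht => h t ?_
  simp only [List.mem_reverse, List.mem_range'_1] at ht
  exact ht.1

theorem lowerRows_congr {s : ℕ} (h : ∀ t, t ≤ s → row t = row' t) :
    lowerRows row s = lowerRows row' s := by
  unfold lowerRows
  refine List.flatMap_congr fun t ht => h t ?_
  simp only [List.mem_reverse, List.mem_range'_1] at ht
  omega

theorem readingWord_eq (i m : ℕ) (F : ℕ → ℕ → ℕ)
    (h : ∀ r < i, (List.range m).map (F r) = row (r + 1)) :
    readingWord i m F = upperRows (i + 1) row 1 := by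
  have : List.range' 1 i = (List.range i).map (· + 1) := by
    rw [List.range'_eq_map_range]; simp [Nat.add_comm]
  rw [readingWord, upperRows, Nat.add_sub_cancel, this, ← List.map_reverse, List.flatMap_map]
  refine List.flatMap_congr fun r hr => h r ?_
  simpa using hr

end Stacking

theorem word_injective (n i m : ℕ) :
    Function.Injective (Tableau.word : Tableau n i m → List ℕ) := by
  intro S T h
  have h' : (List.range i).reverse.map (fun r => (List.range m).map fun c => S.1 r c)
      = (List.range i).reverse.map (fun r => (List.range m).map fun c => T.1 r c) := by
    rw [List.eq_iff_flatten_eq]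
    refine ⟨h, ?_⟩
    simp [Function.comp_def]
  have key : ∀ r < i, ∀ c < m, S.1 r c = T.1 r c := by
    intro r hr c hc
    have h₁ := List.map_inj_left.1 h' r (by simpa using hr)
    exact List.map_inj_left.1 h₁ c (by simpa using hc)
  refine Subtype.ext (SemistandardYoungTableau.ext fun r c => ?_)
  by_cases hrc : r < i ∧ c < m
  · exact key r hrc.1 c hrc.2
  · have : (r, c) ∉ rect i m := by
      simpa [rect, ← YoungDiagram.mem_cells] using hrc
    rw [S.1.zeros this, T.1.zeros this]

/-! ### Tableaux of shape `(m^{n-1})` as pairs of antitone sequences -/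

/-- A pair of sequences encoding a semistandard tableau with `n-1` rows of length `m` and entries at
most `n+1`: row `s` (numbered from `1`) consists of `x s` entries `s`, then `y s - x s` entries
`s+1`, and then entries `s+2`.  The boundary values at `0` and from `n` on are those for which
the conditions on neighbouring rows make sense for the first and the last row. -/
structure IsProfile (n m : ℕ) (x y : ℕ → ℕ) : Prop where
  x_zero : x 0 = m
  y_zero : y 0 = m
  x_out : ∀ s, n ≤ s → x s = 0
  y_out : ∀ s, n ≤ s → y s = 0
  le : ∀ s, x s ≤ y s
  x_succ_le : ∀ s, x (s + 1) ≤ x s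
  y_succ_le : ∀ s, y (s + 1) ≤ y s

/-- The filling encoded by a profile; as for tableaux, row `s` of the profile has index `s-1`. -/
def profileEntry (n m : ℕ) (x y : ℕ → ℕ) (r c : ℕ) : ℕ :=
  if r < n - 1 ∧ c < m then
    if c < x (r + 1) then r + 1 else if c < y (r + 1) then r + 2 else r + 3
  else 0

/-- The word of row `s` of a profile. -/
def rowWord (m : ℕ) (x y : ℕ → ℕ) (s : ℕ) : List ℕ :=
  List.replicate (x s) s ++ (List.replicate (y s - x s) (s + 1) ++ List.replicate (m - y s) (s + 2))

section Profile

variable {n m : ℕ} {x y : ℕ → ℕ}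

theorem IsProfile.x_antitone (h : IsProfile n m x y) : Antitone x :=
  antitone_nat_of_succ_le h.x_succ_le

theorem IsProfile.y_antitone (h : IsProfile n m x y) : Antitone y :=
  antitone_nat_of_succ_le h.y_succ_le

theorem IsProfile.y_le (h : IsProfile n m x y) (s : ℕ) : y s ≤ m :=
  h.y_zero ▸ h.y_antitone (Nat.zero_le s)

theorem mem_rect {i m r c : ℕ} : (r, c) ∈ rect i m ↔ r < i ∧ c < m := by
  simp [rect, ← YoungDiagram.mem_cells]

/-- The tableau encoded by a profile. -/
def profileTableau (h : IsProfile n m x y) : Tableau n (n - 1) m :=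
  ⟨{ entry := profileEntry n m x y
     row_weak' := by
      intro r c₁ c₂ hc hr
      rw [mem_rect] at hr
      simp only [profileEntry]
      rw [if_pos hr, if_pos ⟨hr.1, hc.trans hr.2⟩]
      have := h.le (r + 1)
      split_ifs <;> omega
     col_strict' := by
      intro r₁ r₂ c hr hc
      rw [mem_rect] at hc
      simp only [profileEntry]
      rw [if_pos hc, if_pos ⟨hr.trans hc.1, hc.2⟩]
      have h₁ := h.x_antitone (show r₁ + 1 ≤ r₂ + 1 by omega)
      have h₂ := h.y_antitone (show r₁ + 1 ≤ r₂ + 1 by omega)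
      split_ifs <;> omega
     zeros' := by
      intro r c hrc
      rw [mem_rect] at hrc
      exact if_neg hrc },
   by
    intro r hr c hc
    change 1 ≤ profileEntry n m x y r c ∧ profileEntry n m x y r c ≤ n + 1
    rw [profileEntry, if_pos ⟨hr, hc⟩]
    split_ifs <;> omega⟩

theorem map_profileEntry (h : IsProfile n m x y) {r : ℕ} (hr : r < n - 1) :
    (List.range m).map (profileEntry n m x y r) = rowWord m x y (r + 1) := by
  have h₁ := h.le (r + 1)
  have h₂ := h.y_le (r + 1)
  have e : List.range m = List.range (x (r + 1)) ++
      ((List.range (y (r + 1) - x (r + 1))).map (x (r + 1) + ·) ++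
        (List.range (m - y (r + 1))).map (y (r + 1) + ·)) := by
    conv_lhs => rw [show m = x (r + 1) + ((y (r + 1) - x (r + 1)) + (m - y (r + 1))) by omega]
    rw [List.range_add, List.range_add, List.map_append, List.map_map]
    congr 3
    funext c
    simp only [Function.comp_apply]; omega
  rw [e, List.map_append, List.map_append, rowWord]
  congr 1
  · refine List.eq_replicate_iff.2 ⟨by simp, fun b hb => ?_⟩
    simp only [List.mem_map, List.mem_range] at hb
    obtain ⟨c, hc, rfl⟩ := hb
    simp only [profileEntry]
    split_ifs <;> omega
  congr 1
  · refine List.eq_replicate_iff.2 ⟨by simp, fun b hb => ?_⟩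
    simp only [List.mem_map, List.mem_range] at hb
    obtain ⟨_, ⟨c, hc, rfl⟩, rfl⟩ := hb
    simp only [profileEntry]
    split_ifs <;> omega
  · refine List.eq_replicate_iff.2 ⟨by simp, fun b hb => ?_⟩
    simp only [List.mem_map, List.mem_range] at hb
    obtain ⟨_, ⟨c, hc, rfl⟩, rfl⟩ := hb
    simp only [profileEntry]
    split_ifs <;> omega

theorem word_profileTableau (hn : 1 ≤ n) (h : IsProfile n m x y) :
    (profileTableau h).word = upperRows n (rowWord m x y) 1 := by
  have := readingWord_eq (n - 1) m (profileEntry n m x y) fun r hr => map_profileEntry h hr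
  rwa [Nat.sub_add_cancel hn] at this

theorem mem_rowWord {s a : ℕ} (ha : a ∈ rowWord m x y s) : s ≤ a ∧ a ≤ s + 2 := by
  simp only [rowWord, List.mem_append, List.mem_replicate] at ha
  omega

theorem mem_upperRows {s a : ℕ} (ha : a ∈ upperRows n (rowWord m x y) s) : s ≤ a := by
  simp only [upperRows, List.mem_flatMap, List.mem_reverse, List.mem_range'_1] at ha
  obtain ⟨t, ht, hat⟩ := ha
  exact ht.1.trans (mem_rowWord hat).1

theorem mem_lowerRows {s a : ℕ} (ha : a ∈ lowerRows (rowWord m x y) s) : a ≤ s + 2 := by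
  simp only [lowerRows, List.mem_flatMap, List.mem_reverse, List.mem_range'_1] at ha
  obtain ⟨t, ht, hat⟩ := ha
  have := (mem_rowWord hat).2
  omega

/-- When the rows down to row `j+1` have been read, exactly the entries `j+1` of that row are open. -/
theorem openAfter_upperRows_succ (h : IsProfile n m x y) (j : ℕ) :
    openAfter j 0 (upperRows n (rowWord m x y) (j + 1)) = x (j + 1) := by
  rcases Nat.lt_or_ge (j + 1) n with hj | hj
  · rw [upperRows_of_lt hj, openAfter_append,
      openAfter_of_forall_ne (w := upperRows n _ _), rowWord, openAfter_append,
      openAfter_replicate_upper, openAfter_of_forall_ne, Nat.zero_add]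
    · intro a ha
      simp only [List.mem_append, List.mem_replicate] at ha
      omega
    · intro a ha
      have := mem_upperRows ha
      omega
  · rw [upperRows_of_le hj, h.x_out _ hj]; rfl

/-- The entries `j+1` of row `j+1` are paired with entries `j` of row `j`, so the open ones after
reading row `j` are the entries `j+1` of row `j`. -/
theorem openAfter_upperRows (h : IsProfile n m x y) (j : ℕ) :
    openAfter j 0 (upperRows n (rowWord m x y) j) = y j - x j := by
  rcases Nat.lt_or_ge j n with hj | hj
  · rw [upperRows_of_lt hj, openAfter_append, openAfter_upperRows_succ h, rowWord, openAfter_append,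
      openAfter_replicate_lower, openAfter_append, openAfter_replicate_upper,
      openAfter_of_forall_ne]
    · have := h.x_succ_le j
      omega
    · intro a ha
      simp only [List.mem_replicate] at ha
      omega
  · rw [upperRows_of_le hj, h.x_out _ hj, h.y_out _ hj]; rfl

/-- In rows `s, …, 1`, a letter `s+2` occurs only in row `s`. -/
theorem allPaired_lowerRows_add_two {s c : ℕ} (hc : m - y s ≤ c) :
    AllPaired (s + 2) c (lowerRows (rowWord m x y) s) := by
  cases s with
  | zero => trivial
  | succ s =>
    rw [lowerRows_succ, rowWord, allPaired_append, allPaired_append, allPaired_append]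
    have h₁ : openAfter (s + 1 + 2) c (List.replicate (x (s + 1)) (s + 1)) = c :=
      openAfter_of_forall_ne _ fun a ha => by
        simp only [List.mem_replicate] at ha
        omega
    have h₂ : openAfter (s + 1 + 2) c
        (List.replicate (y (s + 1) - x (s + 1)) (s + 1 + 1)) = c :=
      openAfter_of_forall_ne _ fun a ha => by
        simp only [List.mem_replicate] at ha
        omega
    refine ⟨⟨allPaired_of_forall_ne _ fun a ha => ?_, allPaired_of_forall_ne _ fun a ha => ?_, ?_⟩,
      allPaired_of_forall_ne _ fun a ha => ?_⟩
    · simp only [List.mem_replicate] at ha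
      omega
    · simp only [List.mem_replicate] at ha
      omega
    · rw [h₁, h₂, allPaired_replicate_lower]
      exact hc
    · have := mem_lowerRows ha
      omega

theorem allPaired_lowerRows_add_one (h : IsProfile n m x y) {s c : ℕ} (hc : y s - x s ≤ c) :
    AllPaired (s + 1) c (lowerRows (rowWord m x y) s) := by
  cases s with
  | zero => trivial
  | succ s =>
    rw [lowerRows_succ, rowWord, allPaired_append, allPaired_append, allPaired_append]
    have h₁ : ∀ c, openAfter (s + 1 + 1) c (List.replicate (x (s + 1)) (s + 1)) = c := fun c =>
      openAfter_of_forall_ne _ fun a ha => by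
        simp only [List.mem_replicate] at ha
        omega
    refine ⟨⟨allPaired_of_forall_ne _ fun a ha => ?_, ?_, allPaired_of_forall_ne _ fun a ha => ?_⟩,
      allPaired_lowerRows_add_two ?_⟩
    · simp only [List.mem_replicate] at ha
      omega
    · rw [h₁, allPaired_replicate_lower]
      exact hc
    · simp only [List.mem_replicate] at ha
      omega
    · rw [openAfter_append, openAfter_append, h₁, openAfter_replicate_lower,
        openAfter_replicate_upper]
      have := h.y_succ_le s
      omega

/-! ### The lowering operators on profiles -/

theorem f_eq_some {i : ℕ} {j : ℕ} (hj : j ≠ 0) {S T : Tableau n i m}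
    (h : wordF j S.word = some T.word) : (tableauCrystal n i m).f j S = some T := by
  simp only [tableauCrystal, if_neg hj]
  exact induced_eq_some (word_injective n i m) h

/-- The value of an operator on tableaux is the tableau with the given profile; in particular it is
not `0`. -/
def Reaches (n m : ℕ) (o : Option (Tableau n (n - 1) m)) (x y : ℕ → ℕ) : Prop :=
  ∃ h : IsProfile n m x y, o = some (profileTableau h)

/-- If row `s` has more entries `s+1` than row `s+1` has entries `s+2`, then `f_{s+1}` acts on row
`s`. -/
theorem IsProfile.reaches_f_upper (h : IsProfile n m x y) {s : ℕ} (hs : s < n)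
    (hlt : y (s + 1) - x (s + 1) < y s - x s) :
    Reaches n m ((tableauCrystal n (n - 1) m).f (s + 1) (profileTableau h)) x
      (Function.update y s (y s - 1)) := by
  have hs0 : s ≠ 0 := by
    rintro rfl
    rw [h.x_zero, h.y_zero] at hlt
    omega
  have h' : IsProfile n m x (Function.update y s (y s - 1)) := by
    have hle := h.le
    have hxs := h.x_succ_le
    refine ⟨h.x_zero, ?_, h.x_out, ?_, ?_, hxs, ?_⟩
    · rw [Function.update_of_ne (Ne.symm hs0), h.y_zero]
    · intro t ht
      rw [Function.update_of_ne (by omega), h.y_out t ht]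
    · intro t
      rcases eq_or_ne t s with rfl | ht
      · rw [Function.update_self]; omega
      · rw [Function.update_of_ne ht]; exact hle t
    · intro t
      have h₁ := h.y_succ_le t
      rcases eq_or_ne t s with rfl | ht
      · rw [Function.update_self, Function.update_of_ne (by omega)]
        have := hxs t
        omega
      · rw [Function.update_of_ne ht]
        rcases eq_or_ne (t + 1) s with rfl | ht'
        · rw [Function.update_self]; omega
        · rw [Function.update_of_ne ht']; exact h₁
  refine ⟨h', f_eq_some (by omega) ?_⟩
  obtain ⟨t, rfl⟩ := Nat.exists_eq_succ_of_ne_zero hs0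
  simp only [Nat.succ_eq_add_one] at *
  have hrow : ∀ r, r ≠ t + 1 →
      rowWord m x y r = rowWord m x (Function.update y (t + 1) (y (t + 1) - 1)) r := by
    intro r hr
    simp only [rowWord, Function.update_of_ne hr]
  have hy := h.y_le (t + 1)
  rw [word_profileTableau (by omega), word_profileTableau (by omega),
    ← upperRows_append_lowerRows hs, ← upperRows_append_lowerRows hs, lowerRows_succ,
    lowerRows_succ, ← upperRows_congr fun r hr => hrow r (by omega),
    ← lowerRows_congr fun r hr => hrow r (by omega)]
  have e₁ : rowWord m x y (t + 1) = (List.replicate (x (t + 1)) (t + 1) ++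
      List.replicate (y (t + 1) - x (t + 1) - 1) (t + 1 + 1)) ++
        (t + 1 + 1) :: List.replicate (m - y (t + 1)) (t + 1 + 2) := by
    rw [rowWord]
    conv_lhs => rw [show y (t + 1) - x (t + 1) = y (t + 1) - x (t + 1) - 1 + 1 by omega,
      List.replicate_succ']
    simp
  have e₂ : rowWord m x (Function.update y (t + 1) (y (t + 1) - 1)) (t + 1) =
      (List.replicate (x (t + 1)) (t + 1) ++
      List.replicate (y (t + 1) - x (t + 1) - 1) (t + 1 + 1)) ++
        (t + 1 + 1 + 1) :: List.replicate (m - y (t + 1)) (t + 1 + 2) := by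
    rw [rowWord, Function.update_self, show y (t + 1) - 1 - x (t + 1) = y (t + 1) - x (t + 1) - 1
      by omega, show m - (y (t + 1) - 1) = m - y (t + 1) + 1 by omega, List.replicate_succ]
    simp
  rw [e₁, e₂]
  have h₁ : ∀ c, openAfter (t + 1 + 1) c (List.replicate (x (t + 1)) (t + 1)) = c := fun c =>
    openAfter_of_forall_ne _ fun a ha => by
      simp only [List.mem_replicate] at ha
      omega
  have := wordF_append_cons (j := t + 1 + 1)
    (u := upperRows n (rowWord m x y) (t + 1 + 1) ++ (List.replicate (x (t + 1)) (t + 1) ++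
      List.replicate (y (t + 1) - x (t + 1) - 1) (t + 1 + 1)))
    (v := List.replicate (m - y (t + 1)) (t + 1 + 2) ++ lowerRows (rowWord m x y) t)
    (by
      rw [openAfter_append, openAfter_upperRows h, openAfter_append, h₁, openAfter_replicate_lower]
      omega)
    (by
      rw [allPaired_append]
      refine ⟨allPaired_of_forall_ne _ fun a ha => ?_, allPaired_lowerRows_add_two ?_⟩
      · simp only [List.mem_replicate] at ha
        omega
      · rw [show t + 1 + 2 = t + 1 + 1 + 1 from rfl, openAfter_replicate_upper]
        have := h.y_succ_le t
        omega)
  simpa only [List.append_assoc, List.cons_append] using this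

/-- If row `s` has at most as many entries `s+1` as row `s+1` has entries `s+2`, then `f_{s+1}` acts
on row `s+1`, as long as the result is semistandard. -/
theorem IsProfile.reaches_f_lower (h : IsProfile n m x y) {s : ℕ}
    (hle : y s - x s ≤ y (s + 1) - x (s + 1)) (hlt : x (s + 2) < x (s + 1)) :
    Reaches n m ((tableauCrystal n (n - 1) m).f (s + 1) (profileTableau h))
      (Function.update x (s + 1) (x (s + 1) - 1)) y := by
  have hs : s + 1 < n := by
    by_contra hs
    rw [h.x_out (s + 1) (by omega)] at hlt
    omega
  have h' : IsProfile n m (Function.update x (s + 1) (x (s + 1) - 1)) y := by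
    refine ⟨?_, h.y_zero, ?_, h.y_out, ?_, ?_, h.y_succ_le⟩
    · rw [Function.update_of_ne (by omega), h.x_zero]
    · intro t ht
      rw [Function.update_of_ne (by omega), h.x_out t ht]
    · intro t
      have := h.le t
      rcases eq_or_ne t (s + 1) with rfl | ht
      · rw [Function.update_self]; omega
      · rw [Function.update_of_ne ht]; exact this
    · intro t
      have h₁ := h.x_succ_le t
      rcases eq_or_ne t (s + 1) with rfl | ht
      · rw [Function.update_self, Function.update_of_ne (by omega)]
        change x (s + 2) ≤ _
        omega
      · rw [Function.update_of_ne ht]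
        rcases eq_or_ne (t + 1) (s + 1) with ht' | ht'
        · rw [ht', Function.update_self]
          rw [ht'] at h₁
          omega
        · rw [Function.update_of_ne ht']; exact h₁
  refine ⟨h', f_eq_some (by omega) ?_⟩
  have hrow : ∀ r, r ≠ s + 1 →
      rowWord m x y r = rowWord m (Function.update x (s + 1) (x (s + 1) - 1)) y r := by
    intro r hr
    simp only [rowWord, Function.update_of_ne hr]
  have hxy := h.le (s + 1)
  rw [word_profileTableau (by omega), word_profileTableau (by omega),
    ← upperRows_append_lowerRows hs, ← upperRows_append_lowerRows hs, lowerRows_succ,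
    lowerRows_succ, ← upperRows_congr fun r hr => hrow r (by omega),
    ← lowerRows_congr fun r hr => hrow r (by omega)]
  have e₁ : rowWord m x y (s + 1) = List.replicate (x (s + 1) - 1) (s + 1) ++
      (s + 1) :: (List.replicate (y (s + 1) - x (s + 1)) (s + 1 + 1) ++
        List.replicate (m - y (s + 1)) (s + 1 + 2)) := by
    rw [rowWord]
    conv_lhs => enter [1]; rw [show x (s + 1) = x (s + 1) - 1 + 1 by omega, List.replicate_succ']
    simp
  have e₂ : rowWord m (Function.update x (s + 1) (x (s + 1) - 1)) y (s + 1) =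
      List.replicate (x (s + 1) - 1) (s + 1) ++
      (s + 1 + 1) :: (List.replicate (y (s + 1) - x (s + 1)) (s + 1 + 1) ++
        List.replicate (m - y (s + 1)) (s + 1 + 2)) := by
    rw [rowWord, Function.update_self,
      show y (s + 1) - (x (s + 1) - 1) = y (s + 1) - x (s + 1) + 1 by omega, List.replicate_succ]
    simp
  rw [e₁, e₂]
  have := wordF_append_cons (j := s + 1)
    (u := upperRows n (rowWord m x y) (s + 1 + 1) ++ List.replicate (x (s + 1) - 1) (s + 1))
    (v := (List.replicate (y (s + 1) - x (s + 1)) (s + 1 + 1) ++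
        List.replicate (m - y (s + 1)) (s + 1 + 2)) ++ lowerRows (rowWord m x y) s)
    (by
      rw [openAfter_append, openAfter_upperRows_succ h, openAfter_replicate_lower]
      change x (s + 2) - _ = 0
      omega)
    (by
      have h₂ : ∀ c, openAfter (s + 1) c (List.replicate (m - y (s + 1)) (s + 1 + 2)) = c :=
        fun c => openAfter_of_forall_ne _ fun a ha => by
          simp only [List.mem_replicate] at ha
          omega
      rw [allPaired_append]
      refine ⟨allPaired_of_forall_ne _ fun a ha => ?_, allPaired_lowerRows_add_one h ?_⟩
      · simp only [List.mem_append, List.mem_replicate] at ha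
        omega
      · rw [openAfter_append, openAfter_replicate_upper, h₂]
        omega)
  simpa only [List.append_assoc, List.cons_append] using this

theorem Reaches.congr {o : Option (Tableau n (n - 1) m)} {x' y' : ℕ → ℕ} (h : Reaches n m o x y)
    (hx : x = x') (hy : y = y') : Reaches n m o x' y' := hx ▸ hy ▸ h

theorem Reaches.powOp_upper {o : Option (Tableau n (n - 1) m)} (h : Reaches n m o x y) {s : ℕ}
    (hs : s < n) {d : ℕ} (hd : d + (y (s + 1) - x (s + 1)) ≤ y s - x s) :
    Reaches n m (powOp ((tableauCrystal n (n - 1) m).f (s + 1)) d o) x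
      (Function.update y s (y s - d)) := by
  induction d with
  | zero => simpa [powOp_zero] using h
  | succ d ih =>
    obtain ⟨h', e⟩ := ih (by omega)
    rw [powOp_succ, e, Option.bind_some]
    refine (h'.reaches_f_upper hs ?_).congr rfl ?_
    · rw [Function.update_self, Function.update_of_ne (by omega)]; omega
    · rw [Function.update_self, Function.update_idem, Nat.sub_sub]

theorem Reaches.powOp_lower {o : Option (Tableau n (n - 1) m)} (h : Reaches n m o x y) {s : ℕ}
    (hle : y s - x s ≤ y (s + 1) - x (s + 1)) {d : ℕ} (hd : x (s + 2) + d ≤ x (s + 1)) :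
    Reaches n m (powOp ((tableauCrystal n (n - 1) m).f (s + 1)) d o)
      (Function.update x (s + 1) (x (s + 1) - d)) y := by
  induction d with
  | zero => simpa [powOp_zero] using h
  | succ d ih =>
    obtain ⟨h', e⟩ := ih (by omega)
    rw [powOp_succ, e, Option.bind_some]
    refine (h'.reaches_f_lower ?_ ?_).congr ?_ rfl
    · rw [Function.update_self, Function.update_of_ne (by omega)]; omega
    · rw [Function.update_self, Function.update_of_ne (by omega)]; omega
    · rw [Function.update_self, Function.update_idem, Nat.sub_sub]

/-- A power of `f_{s+1}` first acts on row `s`, as long as that row has more entries `s+1` than row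
`s+1` has entries `s+2`, and then on row `s+1`. -/
theorem Reaches.powOp_f {o : Option (Tableau n (n - 1) m)} (h : Reaches n m o x y) {s : ℕ}
    (hs : s < n) {d e : ℕ} (hd : d + (y (s + 1) - x (s + 1)) ≤ y s - x s)
    (he : x (s + 2) + e ≤ x (s + 1)) (hde : e = 0 ∨ y s - x s ≤ d + (y (s + 1) - x (s + 1))) :
    Reaches n m (powOp ((tableauCrystal n (n - 1) m).f (s + 1)) (d + e) o)
      (Function.update x (s + 1) (x (s + 1) - e)) (Function.update y s (y s - d)) := by
  have h₁ := h.powOp_upper hs hd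
  rw [powOp_add]
  rcases hde with rfl | hde
  · simpa [powOp_zero] using h₁
  · refine h₁.powOp_lower ?_ he
    rw [Function.update_self, Function.update_of_ne (by omega)]
    omega

end Profile

/-! ### The statistics `Ω` and `ν` -/

section Statistics

variable {n m : ℕ} {a : ℕ → ℕ → ℕ}

theorem Omega_one : Omega n a 1 = -(a 1 (n - 1) : ℤ) := rfl

theorem nu_one : nu n a 1 = 1 := rfl

theorem Omega_succ {k : ℕ} (hk : k ≠ 0) : Omega n a (k + 1) =
    a k n + (1 - nu n a k) * Omega n a k - a (k + 1) (n - 1) := by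
  obtain ⟨k, rfl⟩ := Nat.exists_eq_succ_of_ne_zero hk
  rfl

theorem nu_succ {k : ℕ} (hk : k ≠ 0) :
    nu n a (k + 1) = if Omega n a (k + 1) < 0 then 1 else 0 := by
  obtain ⟨k, rfl⟩ := Nat.exists_eq_succ_of_ne_zero hk
  rfl

theorem nu_mul_Omega {k : ℕ} (hk : k ≠ 0) : nu n a k * Omega n a k = min (Omega n a k) 0 := by
  obtain ⟨k, rfl⟩ := Nat.exists_eq_succ_of_ne_zero hk
  rcases eq_or_ne k 0 with rfl | hk'
  · rw [nu_one, Omega_one]; omega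
  · rw [Nat.succ_eq_add_one, nu_succ hk']
    split_ifs <;> omega

theorem one_sub_nu_mul_Omega {k : ℕ} (hk : k ≠ 0) :
    (1 - nu n a k) * Omega n a k = max (Omega n a k) 0 := by
  rw [sub_mul, nu_mul_Omega hk]; omega

theorem Omega_add_nonneg {k : ℕ} (hk : k ≠ 0) : 0 ≤ Omega n a k + a k (n - 1) := by
  obtain ⟨k, rfl⟩ := Nat.exists_eq_succ_of_ne_zero hk
  rcases eq_or_ne k 0 with rfl | hk'
  · change 0 ≤ Omega n a 1 + (a 1 (n - 1) : ℤ)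
    rw [Omega_one]; omega
  · rw [Nat.succ_eq_add_one, Omega_succ hk', one_sub_nu_mul_Omega hk']; omega

/-- The recursion for `Ω` telescopes. -/
theorem sum_nu_mul_Omega (n : ℕ) (a : ℕ → ℕ → ℕ) (k : ℕ) :
    ∑ j ∈ Icc 1 (k + 1), nu n a j * Omega n a j + (1 - nu n a (k + 1)) * Omega n a (k + 1) =
      ∑ j ∈ Icc 1 k, (a j n : ℤ) - ∑ j ∈ Icc 1 (k + 1), (a j (n - 1) : ℤ) := by
  induction k with
  | zero => simp [nu_one, Omega_one]
  | succ k ih =>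
    rw [sum_Icc_succ_top (show 1 ≤ k + 1 + 1 by omega), sum_Icc_succ_top (show 1 ≤ k + 1 by omega)
      (fun j => (a j n : ℤ)), sum_Icc_succ_top (show 1 ≤ k + 1 + 1 by omega)
      (fun j => (a j (n - 1) : ℤ)), Omega_succ (Nat.succ_ne_zero k)]
    linarith

/-- The Dyck path that goes down the column `n-1` to row `p`, and then down the column `n`. -/
theorem IsPolytopePoint.sum_add_sum_le (hA : IsPolytopePoint n (n - 1) m a) {p : ℕ} (hp : 1 ≤ p)
    (hpn : p < n) : ∑ j ∈ Icc 1 p, a j (n - 1) + ∑ j ∈ Icc p (n - 1), a j n ≤ m := by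
  have h := hA.dyck (fun r => if r ≤ p then (r, n - 1) else (r - 1, n)) (by
    refine ⟨by simp [hp], by simp [hpn], fun r hr hrn => ?_⟩
    dsimp only
    rcases lt_trichotomy r p with h | rfl | h
    · rw [if_pos (show r + 1 ≤ p by omega), if_pos h.le]
      exact Or.inr rfl
    · rw [if_neg (by omega), if_pos le_rfl]
      left
      ext <;> simp; omega
    · rw [if_neg (by omega), if_neg (by omega)]
      right
      ext <;> simp; omega)
  refine le_of_eq_of_le ?_ h
  have e : Icc 1 n = Icc 1 p ∪ (Icc p (n - 1)).map (addRightEmbedding 1) := by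
    rw [map_add_right_Icc, Nat.sub_add_cancel (by omega)]
    ext r
    simp only [mem_union, mem_Icc]
    omega
  rw [e, sum_union, sum_map]
  · congr 1
    · refine sum_congr rfl fun r hr => ?_
      rw [if_pos (mem_Icc.1 hr).2]
    · refine sum_congr rfl fun r hr => ?_
      have := (mem_Icc.1 hr).1
      rw [addRightEmbedding_apply, if_neg (by omega), Nat.add_sub_cancel]
  · rw [map_add_right_Icc, disjoint_left]
    intro r h₁ h₂
    simp only [mem_Icc] at h₁ h₂
    omega

/-- The partial sums of `-ν_j Ω_j` are maxima of differences which the Dyck paths bound. -/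
theorem IsPolytopePoint.neg_sum_nu_mul_Omega_le (hA : IsPolytopePoint n (n - 1) m a) (hn : 2 ≤ n)
    {k : ℕ} (hk : k < n) :
    -∑ j ∈ Icc 1 k, nu n a j * Omega n a j ≤ m - ∑ j ∈ Icc 1 (n - 1), (a j n : ℤ) := by
  induction k with
  | zero =>
    have h := hA.sum_add_sum_le le_rfl (by omega)
    zify at h
    simp only [Icc_self, sum_singleton] at h
    simp only [show Icc 1 0 = (∅ : Finset ℕ) from rfl, sum_empty, neg_zero]
    omega
  | succ k ih =>
    have ih := ih (by omega)
    have h := hA.sum_add_sum_le (p := k + 1) (by omega) hk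
    zify at h
    have hs : ∑ j ∈ Icc 1 (n - 1), (a j n : ℤ)
        = ∑ j ∈ Icc 1 k, (a j n : ℤ) + ∑ j ∈ Icc (k + 1) (n - 1), (a j n : ℤ) := by
      rw [← sum_union]
      · congr 1
        ext r
        simp only [mem_union, mem_Icc]
        omega
      · rw [disjoint_left]
        intro r h₁ h₂
        simp only [mem_Icc] at h₁ h₂
        omega
    have ht := sum_nu_mul_Omega n a k
    have hmin := nu_mul_Omega (n := n) (a := a) (Nat.succ_ne_zero k)
    have hmax := one_sub_nu_mul_Omega (n := n) (a := a) (Nat.succ_ne_zero k)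
    rw [Nat.succ_eq_add_one] at hmin hmax
    rw [sum_Icc_succ_top (by omega) (fun j => nu n a j * Omega n a j)] at ht ⊢
    rw [hmin, hmax] at ht
    rw [hmin]
    omega

end Statistics

/-! ### The tableaux `T^{(k)}` -/

section TableauSeq

variable {n m : ℕ}

theorem opH_eq (hn : 2 ≤ n) (a : ℕ → ℕ → ℕ) : opH n (n - 1) a =
    [(n, ∑ p ∈ Icc 1 (n - 1), a p n), (n - 1, ∑ p ∈ Icc 1 (n - 1), a p n)] := by
  obtain ⟨i, rfl⟩ := Nat.exists_eq_add_of_le' hn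
  rw [opH, List.Ico.eq_cons (by omega), List.Ico.eq_cons (by omega),
    List.Ico.eq_nil_of_le (by omega)]
  simp only [List.map_cons, List.map_nil]
  rw [show i + 2 + (i + 2 - 1) - (i + 2 - 1) = i + 2 by omega,
    show i + 2 + (i + 2 - 1) - (i + 2 - 1 + 1) = i + 2 - 1 by omega]

theorem opY_eq (hn : 2 ≤ n) (a : ℕ → ℕ → ℕ) (l : ℕ) : opY n (n - 1) a l =
    ((List.Ico l (n - 1)).map fun j => (j, a l (n - 1) + a l n)) ++ [(n - 1, a l (n - 1))] := by
  obtain ⟨i, rfl⟩ := Nat.exists_eq_add_of_le' hn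
  have e₁ : ∑ p ∈ Icc (i + 2 - 1) (i + 2), a l p = a l (i + 2 - 1) + a l (i + 2) := by
    change ∑ p ∈ Icc (i + 1) (i + 1 + 1), a l p = a l (i + 1) + a l (i + 1 + 1)
    rw [sum_Icc_succ_top (by omega), Icc_self, sum_singleton]
  have e₂ : List.Ico (i + 2 - 1) (i + 2) = [i + 2 - 1] := List.Ico.succ_singleton
  rw [opY, e₁, e₂]
  simp only [List.map_cons, List.map_nil]
  rw [show i + 2 - 1 + (i + 2 - 1) - (i + 2 - 1) = i + 2 - 1 by omega, Icc_self, sum_singleton]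

theorem reaches_highestTableau (hn : 2 ≤ n) : Reaches n m
    (some (highestTableau n (n - 1) m (Nat.sub_le n 1)))
    (fun s => if s < n then m else 0) (fun s => if s < n then m else 0) := by
  refine ⟨⟨if_pos (by omega), if_pos (by omega), fun s hs => if_neg (by omega),
    fun s hs => if_neg (by omega), fun s => le_rfl, ?_, ?_⟩, ?_⟩
  · intro s; split_ifs <;> omega
  · intro s; split_ifs <;> omega
  · refine congrArg some (Subtype.ext (SemistandardYoungTableau.ext fun r c => ?_))
    change (if r < n - 1 ∧ c < m then r + 1 else 0) =
      profileEntry n m (fun s => if s < n then m else 0) (fun s => if s < n then m else 0) r c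
    rw [profileEntry]
    split_ifs <;> omega

theorem reaches_opH (hn : 2 ≤ n) (a : ℕ → ℕ → ℕ) (hc : ∑ p ∈ Icc 1 (n - 1), a p n ≤ m) :
    Reaches n m (prodOp (tableauCrystal n (n - 1) m).f (opH n (n - 1) a)
      (some (highestTableau n (n - 1) m (Nat.sub_le n 1))))
      (fun s => if s + 1 < n then m else if s < n then m - ∑ p ∈ Icc 1 (n - 1), a p n else 0)
      (fun s => if s + 1 < n then m else if s < n then m - ∑ p ∈ Icc 1 (n - 1), a p n else 0) := by
  rw [opH_eq hn]
  obtain ⟨i, rfl⟩ := Nat.exists_eq_add_of_le' hn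
  generalize ∑ p ∈ Icc 1 (i + 2 - 1), a p (i + 2) = c at hc ⊢
  rw [prodOp_cons, prodOp_cons, prodOp_nil]
  have h₁ := (reaches_highestTableau (m := m) hn).powOp_lower (s := i) (d := c)
    (by simp) (by simp [hc])
  have h₂ := h₁.powOp_upper (s := i + 1) (d := c) (by omega) (by
    simp only [Function.update_self, Function.update_of_ne (show i + 1 + 1 ≠ i + 1 by omega)]
    rw [if_neg (by omega), if_pos (by omega)]
    omega)
  refine h₂.congr ?_ ?_ <;>
  · funext s
    simp only [Function.update_apply]
    split_ifs <;> omega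

/-- The effect of `f_l^{d+e} ⋯ f_{n-2}^{d+e}` when the rows from `l-1` to `n-2` agree: each factor
`f_j` changes `d` entries in row `j-1` and `e` entries in row `j`, since row `j` has lost `d` entries
`j+1` just before. -/
theorem Reaches.prodOp_sweep {x y : ℕ → ℕ} {o : Option (Tableau n (n - 1) m)} {X Y d e k : ℕ}
    (hX : ∀ s, k ≤ s → s + 1 < n → x s = X)
    (hY : ∀ s, k ≤ s → s + 1 < n → y s = Y) (hd : d + X ≤ Y) (he : x (n - 1) + e ≤ X)
    (h : Reaches n m o x fun s => if s + 2 = n then y s - d else y s)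
    {l : ℕ} (hkl : k + 1 ≤ l) (hl : l ≤ n - 1) :
    Reaches n m (prodOp (tableauCrystal n (n - 1) m).f
        ((List.Ico l (n - 1)).map fun j => (j, d + e)) o)
      (fun s => if l ≤ s ∧ s + 1 < n then x s - e else x s)
      (fun s => if l ≤ s + 1 ∧ s + 1 < n then y s - d else y s) := by
  induction hl using Nat.decreasingInduction with
  | self =>
    rw [List.Ico.eq_nil_of_le le_rfl, List.map_nil, prodOp_nil]
    refine h.congr ?_ ?_ <;>
    · funext s
      split_ifs <;> omega
  | of_succ l hl ih =>
    obtain ⟨l, rfl⟩ := Nat.exists_eq_add_of_le' (show 1 ≤ l by omega)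
    rw [List.Ico.eq_cons hl, List.map_cons, prodOp_cons]
    have x₁ := hX l (by omega) (by omega)
    have x₂ := hX (l + 1) (by omega) (by omega)
    have y₁ := hY l (by omega) (by omega)
    have y₂ := hY (l + 1) (by omega) (by omega)
    refine ((ih (by omega)).powOp_f (s := l) (d := d) (e := e) (by omega) ?_ ?_ ?_).congr ?_ ?_
    · split_ifs <;> omega
    · have x₃ : l + 2 + 1 < n → x (l + 2) = X := hX (l + 2) (by omega)
      have x₄ : l + 2 + 1 = n → x (l + 2) = x (n - 1) := by rintro rfl; rfl
      split_ifs <;> omega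
    · right
      split_ifs <;> omega
    · funext s
      rcases eq_or_ne s (l + 1) with rfl | hs
      · rw [Function.update_self]
        split_ifs <;> omega
      · rw [Function.update_of_ne hs]
        split_ifs <;> omega
    · funext s
      rcases eq_or_ne s l with rfl | hs
      · rw [Function.update_self]
        split_ifs <;> omega
      · rw [Function.update_of_ne hs]
        split_ifs <;> omega

/-- The effect of `Y(i)_{k+1}`. -/
theorem Reaches.prodOp_opY (hn : 2 ≤ n) {x y : ℕ → ℕ} {o : Option (Tableau n (n - 1) m)}
    {a : ℕ → ℕ → ℕ} {X Y d g e k : ℕ} (hk : k + 1 < n) (h : Reaches n m o x y)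
    (hX : ∀ s, k ≤ s → s + 1 < n → x s = X) (hY : ∀ s, k ≤ s → s + 1 < n → y s = Y)
    (hdg : a (k + 1) (n - 1) = d + g) (hde : a (k + 1) (n - 1) + a (k + 1) n = d + e)
    (hd : d + (y (n - 1) - x (n - 1)) ≤ Y - X)
    (hg : g = 0 ∨ Y - X ≤ d + (y (n - 1) - x (n - 1)))
    (hgx : g ≤ x (n - 1)) (he : x (n - 1) + e ≤ X + g) :
    Reaches n m (prodOp (tableauCrystal n (n - 1) m).f (opY n (n - 1) a (k + 1)) o)
      (fun s => if k + 1 ≤ s ∧ s + 1 < n then x s - e else if s + 1 = n then x s - g else x s)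
      (fun s => if k ≤ s ∧ s + 1 < n then y s - d else y s) := by
  rw [opY_eq hn, prodOp_append, hde, prodOp_cons, prodOp_nil, hdg]
  have x₁ := hX (n - 2) (by omega) (by omega)
  have y₁ := hY (n - 2) (by omega) (by omega)
  have hXY : X ≤ Y := by
    obtain ⟨h, -⟩ := h
    have := h.le (n - 2)
    omega
  have hn1 : n - 2 + 1 = n - 1 := by omega
  have h₁ := h.powOp_f (s := n - 2) (d := d) (e := g) (by omega) (by rw [hn1]; omega)
    (by
      obtain ⟨h, -⟩ := h
      rw [h.x_out (n - 2 + 2) (by omega), hn1]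
      omega)
    (by rw [hn1]; omega)
  rw [hn1] at h₁
  have h₂ := (h₁.congr (y' := fun s => if s + 2 = n then y s - d else y s) rfl (by
    funext s
    rw [Function.update_apply]
    split_ifs with h₁ h₂ h₂
    · rw [h₁]
    · omega
    · omega
    · rfl)).prodOp_sweep (k := k) (l := k + 1) (X := X) (Y := Y) (e := e)
    (by
      intro s hs hsn
      rw [Function.update_of_ne (by omega), hX s hs hsn])
    hY (by omega) (by rw [Function.update_self]; omega) le_rfl (by omega)
  refine h₂.congr ?_ ?_
  · funext s
    simp only [Function.update_apply]
    have : s + 1 = n → x s = x (n - 1) := by rintro rfl; rfl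
    split_ifs <;> omega
  · funext s
    split_ifs <;> omega

/-- The profile of `T^{(k)}`. -/
theorem exists_reaches_tableauSeq (hn : 2 ≤ n) {a : ℕ → ℕ → ℕ}
    (hA : IsPolytopePoint n (n - 1) m a) {k : ℕ} (hk : k < n) :
    ∃ x y : ℕ → ℕ, Reaches n m (tableauSeq n (n - 1) m (Nat.sub_le n 1) a k) x y ∧
      (∀ s, s + 1 < n →
        (x s : ℤ) = m - ∑ j ∈ Icc 1 (min s k), ((a j n : ℤ) - nu n a j * Omega n a j)) ∧
      (∀ s, s + 1 < n → (y s : ℤ) =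
        m - ∑ j ∈ Icc 1 (min (s + 1) k), ((a j (n - 1) : ℤ) + nu n a j * Omega n a j)) ∧
      (x (n - 1) : ℤ) =
        m - ∑ j ∈ Icc 1 (n - 1), (a j n : ℤ) + ∑ j ∈ Icc 1 k, nu n a j * Omega n a j ∧
      (y (n - 1) : ℤ) = m - ∑ j ∈ Icc 1 (n - 1), (a j n : ℤ) := by
  induction k with
  | zero =>
    have hc : ∑ p ∈ Icc 1 (n - 1), a p n ≤ m := by
      have := hA.neg_sum_nu_mul_Omega_le hn hk
      simp only [show Icc 1 0 = (∅ : Finset ℕ) from rfl, sum_empty, neg_zero] at this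
      zify
      omega
    refine ⟨_, _, reaches_opH hn a hc, ?_, ?_, ?_, ?_⟩
    · intro s hs
      simp [hs]
    · intro s hs
      simp [hs]
    · rw [if_neg (by omega), if_pos (by omega)]
      push_cast [hc]
      simp
    · rw [if_neg (by omega), if_pos (by omega)]
      push_cast [hc]
      simp
  | succ k ih =>
    obtain ⟨x, y, h, hx, hy, hxn, hyn⟩ := ih (by omega)
    have hle : ∀ s, x s ≤ y s := by
      obtain ⟨h, -⟩ := h
      exact h.le
    have hle₁ := hle (n - 1)
    have hle₂ := hle k
    have hxk := hx k (by omega)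
    have hyk := hy k (by omega)
    rw [min_self, sum_sub_distrib] at hxk
    rw [min_eq_right (by omega), sum_add_distrib] at hyk
    have hw := nu_mul_Omega (n := n) (a := a) (Nat.succ_ne_zero k)
    have hw' := one_sub_nu_mul_Omega (n := n) (a := a) (Nat.succ_ne_zero k)
    have hΩ := Omega_add_nonneg (n := n) (a := a) (Nat.succ_ne_zero k)
    have hb := hA.neg_sum_nu_mul_Omega_le hn hk
    have ht := sum_nu_mul_Omega n a k
    have hck : ∑ j ∈ Icc 1 (k + 1), (a j n : ℤ) ≤ ∑ j ∈ Icc 1 (n - 1), (a j n : ℤ) :=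
      sum_le_sum_of_subset_of_nonneg (Icc_subset_Icc_right (by omega)) fun _ _ _ => by positivity
    rw [Nat.succ_eq_add_one] at hw hw' hΩ
    rw [sum_Icc_succ_top (by omega) (fun j => nu n a j * Omega n a j)] at hb ht
    rw [sum_Icc_succ_top (by omega)] at ht hck
    rw [hw'] at ht
    rw [hw] at hb ht
    have hX : ∀ s, k ≤ s → s + 1 < n → x s = x k := by
      intro s hs hsn
      zify
      rw [hx s hsn, hx k (by omega), min_eq_right hs, min_self]
    have hY : ∀ s, k ≤ s → s + 1 < n → y s = y k := by
      intro s hs hsn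
      zify
      rw [hy s hsn, hy k (by omega), min_eq_right (by omega), min_eq_right (by omega)]
    -- `f_{n-1}` first acts `min (a_{k+1,n-1}) (Ω_{k+1} + a_{k+1,n-1})` times on row `n-2`.
    obtain ⟨d, hd⟩ := Int.eq_ofNat_of_zero_le
      (show 0 ≤ (a (k + 1) (n - 1) : ℤ) + min (Omega n a (k + 1)) 0 by omega)
    obtain ⟨g, hg⟩ := Int.eq_ofNat_of_zero_le (show 0 ≤ -min (Omega n a (k + 1)) 0 by omega)
    obtain ⟨e, he⟩ := Int.eq_ofNat_of_zero_le
      (show 0 ≤ (a (k + 1) n : ℤ) - min (Omega n a (k + 1)) 0 by omega)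
    have hdx : d ≤ y k := by omega
    have hex : e ≤ x k := by omega
    have hgx : g ≤ x (n - 1) := by omega
    refine ⟨_, _, h.prodOp_opY hn (d := d) (g := g) (e := e) hk hX hY (by omega) (by omega)
      (by omega) (by omega) hgx (by omega), ?_, ?_, ?_, ?_⟩
    · intro s hs
      rcases Nat.lt_or_ge k s with hks | hks
      · rw [if_pos ⟨hks, hs⟩, hX s hks.le hs, min_eq_right hks, sum_Icc_succ_top (by omega), hw,
          sum_sub_distrib]
        push_cast [hex]
        omega
      · rw [if_neg (by omega), if_neg (by omega), hx s hs, min_eq_left hks,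
          min_eq_left (by omega)]
    · intro s hs
      rcases Nat.lt_or_ge s k with hks | hks
      · rw [if_neg (by omega), hy s hs, min_eq_left hks, min_eq_left (by omega)]
      · rw [if_pos ⟨hks, hs⟩, hY s hks hs, min_eq_right (by omega), sum_Icc_succ_top (by omega), hw,
          sum_add_distrib]
        push_cast [hdx]
        omega
    · rw [if_neg (by omega), if_pos (by omega), sum_Icc_succ_top (by omega), hw]
      push_cast [hgx]
      omega
    · rw [if_neg (by omega), hyn]

theorem rowTriple_profileTableau {x y : ℕ → ℕ} (h : IsProfile n m x y) {s : ℕ} (hs : 1 ≤ s)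
    (hsn : s < n) :
    (profileTableau h).rowTriple s = ((x s : ℤ), (y s : ℤ) - x s, (m : ℤ) - y s) := by
  obtain ⟨s, rfl⟩ := Nat.exists_eq_add_of_le' hs
  have h₁ := h.le (s + 1)
  have h₂ := h.y_le (s + 1)
  have e : ∀ t, (profileTableau h).mult (s + 1) t =
      #{c ∈ range m | profileEntry n m x y s c = s + 1 + t - 1} := fun _ => rfl
  have e₁ : ({c ∈ range m | profileEntry n m x y s c = s + 1 + 1 - 1} : Finset ℕ) = range (x (s + 1)) := by
    ext c
    rw [Finset.mem_filter, Finset.mem_range, Finset.mem_range, profileEntry]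
    split_ifs <;> omega
  have e₂ : ({c ∈ range m | profileEntry n m x y s c = s + 1 + 2 - 1} : Finset ℕ) =
      Ico (x (s + 1)) (y (s + 1)) := by
    ext c
    rw [Finset.mem_filter, Finset.mem_range, Finset.mem_Ico, profileEntry]
    split_ifs <;> omega
  have e₃ : ({c ∈ range m | profileEntry n m x y s c = s + 1 + 3 - 1} : Finset ℕ) = Ico (y (s + 1)) m := by
    ext c
    rw [Finset.mem_filter, Finset.mem_range, Finset.mem_Ico, profileEntry]
    split_ifs <;> omega
  rw [Tableau.rowTriple, e, e, e, e₁, e₂, e₃, card_range, Nat.card_Ico, Nat.card_Ico]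
  push_cast [h₁, h₂]
  rfl

end TableauSeq

/-! ### The lowering operators on patterns with two columns -/

theorem firstMax_eq {s : Finset ℕ} {S : ℕ → ℕ} {p : ℕ} (hp : p ∈ s) (hmax : ∀ q ∈ s, S q ≤ S p)
    (hfirst : ∀ q ∈ s, q < p → S q < S p) : firstMax s S = p := by
  have : (s.filter fun p => ∀ q ∈ s, S q ≤ S p).min = (p : WithTop ℕ) := by
    refine le_antisymm (Finset.min_le (Finset.mem_filter.2 ⟨hp, hmax⟩))
      (Finset.le_min fun q hq => ?_)
    rw [Finset.mem_filter] at hq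
    by_contra hlt
    have := hfirst q hq.1 (WithTop.coe_lt_coe.1 (not_le.1 hlt))
    have := hq.2 p hp
    omega
  rw [firstMax, this]
  rfl

theorem lastMax_eq {s : Finset ℕ} {S : ℕ → ℕ} {p : ℕ} (hp : p ∈ s) (hmax : ∀ q ∈ s, S q ≤ S p)
    (hlast : ∀ q ∈ s, p < q → S q < S p) : lastMax s S = p := by
  have : (s.filter fun p => ∀ q ∈ s, S q ≤ S p).max = (p : WithBot ℕ) := by
    refine le_antisymm (Finset.max_le fun q hq => ?_)
      (Finset.le_max (Finset.mem_filter.2 ⟨hp, hmax⟩))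
    rw [Finset.mem_filter] at hq
    by_contra hlt
    have := hlast q hq.1 (WithBot.coe_lt_coe.1 (not_le.1 hlt))
    have := hq.2 p hp
    omega
  rw [lastMax, this]
  rfl

section PolyF

variable {n m : ℕ} {a a' : ℕ → ℕ → ℕ}

theorem eq_of_polyF_pred (hn : 2 ≤ n) (h : polyF n (n - 1) m (n - 1) a = some a') :
    a' = incr (n - 1) (n - 1) a := by
  unfold polyF at h
  rw [if_neg (show n - 1 ≠ 0 by omega), if_pos rfl] at h
  split_ifs at h
  exact (Option.some.inj h).symm

/-- `f_n` on patterns concentrated in row `n-1`. -/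
theorem eq_of_polyF_self (hn : 2 ≤ n) (h : polyF n (n - 1) m n a = some a')
    (h0 : ∀ p q, p ≠ n - 1 → a p q = 0) (hpos : 0 < a (n - 1) (n - 1)) :
    a' = incr (n - 1) n (decr (n - 1) (n - 1) a) := by
  have hS : ∀ q, 1 ≤ q → q ≤ n - 1 → stepPlus (n - 1) n a q =
      (if q = n - 1 then a (n - 1) (n - 1) else 0) + a (n - 1) n := by
    intro q hq hqn
    rw [stepPlus]
    congr 1
    · split_ifs with hqn'
      · rw [hqn']
        exact sum_eq_single_of_mem _ (mem_Icc.2 ⟨by omega, le_rfl⟩) fun j _ hj => h0 j _ hj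
      · refine sum_eq_zero fun j hj => h0 j _ ?_
        have := (mem_Icc.1 hj).2
        omega
    · exact sum_eq_single_of_mem _ (mem_Icc.2 ⟨hqn, le_rfl⟩) fun j _ hj => h0 j _ hj
  have hp : pPlus (n - 1) n a = n - 1 := by
    refine firstMax_eq (mem_Icc.2 ⟨by omega, le_rfl⟩) (fun q hq => ?_) fun q hq hlt => ?_
    · rw [mem_Icc] at hq
      rw [hS q hq.1 hq.2, hS (n - 1) (by omega) le_rfl, if_pos rfl]
      split_ifs <;> omega
    · rw [mem_Icc] at hq
      rw [hS q hq.1 hq.2, hS (n - 1) (by omega) le_rfl, if_pos rfl, if_neg (by omega)]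
      omega
  unfold polyF at h
  rw [if_neg (show n ≠ 0 by omega), if_neg (show n ≠ n - 1 by omega),
    if_pos (show n - 1 < n by omega), hp] at h
  split_ifs at h
  exact (Option.some.inj h).symm

/-- The pattern obtained from `a` by moving `s` units in column `n-1` and `t` units in column `n` from
row `l+1` to row `l` (used when these entries are at least `s` and `t`). -/
def moveUp (n l s t : ℕ) (a : ℕ → ℕ → ℕ) : ℕ → ℕ → ℕ := fun p q =>
  if q = n - 1 then if p = l then a p q + s else if p = l + 1 then a p q - s else a p q
  else if q = n then if p = l then a p q + t else if p = l + 1 then a p q - t else a p q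
  else a p q

/-- For `l < n-1`, the index chosen by `f_l` is `n` if and only if `a_{l+1,n-1} ≤ a_{l,n}`. -/
theorem eq_of_polyF_lt (hn : 2 ≤ n) {l : ℕ} (hl : 1 ≤ l) (hln : l < n - 1)
    (h : polyF n (n - 1) m l a = some a') :
    a' = if a (l + 1) (n - 1) ≤ a l n then moveUp n l 0 1 a else moveUp n l 1 0 a := by
  obtain ⟨i, rfl⟩ := Nat.exists_eq_add_of_le' hn
  rw [show i + 2 - 1 = i + 1 from rfl] at *
  have hS₁ : stepMinus (i + 2) (i + 1) l a (i + 1) =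
      a l (i + 1) + (a (l + 1) (i + 1) + a (l + 1) (i + 2)) := by
    rw [stepMinus, sum_Icc_succ_top (show i + 1 ≤ i + 1 + 1 by omega), Icc_self, sum_singleton,
      sum_singleton]
  have hS₂ : stepMinus (i + 2) (i + 1) l a (i + 2) =
      a l (i + 1) + a l (i + 2) + a (l + 1) (i + 2) := by
    rw [stepMinus, sum_Icc_succ_top (show i + 1 ≤ i + 1 + 1 by omega), Icc_self, Icc_self,
      sum_singleton, sum_singleton]
  have hp : pMinus (i + 2) (i + 1) l a =
      if a (l + 1) (i + 1) ≤ a l (i + 2) then i + 2 else i + 1 := by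
    have hq : ∀ q ∈ Icc (i + 1) (i + 2), q = i + 1 ∨ q = i + 2 := by
      intro q hq
      rw [mem_Icc] at hq
      omega
    split_ifs with hle
    · refine lastMax_eq (mem_Icc.2 ⟨by omega, le_rfl⟩) (fun q hq' => ?_) fun q hq' hlt => ?_
      · rcases hq q hq' with rfl | rfl
        · rw [hS₁, hS₂]; omega
        · exact le_rfl
      · have := (mem_Icc.1 hq').2
        omega
    · refine lastMax_eq (mem_Icc.2 ⟨le_rfl, by omega⟩) (fun q hq' => ?_) fun q hq' hlt => ?_
      · rcases hq q hq' with rfl | rfl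
        · exact le_rfl
        · rw [hS₁, hS₂]; omega
      · rcases hq q hq' with rfl | rfl
        · omega
        · rw [hS₁, hS₂]; omega
  unfold polyF at h
  rw [if_neg (show l ≠ 0 by omega), if_neg (show l ≠ i + 1 by omega),
    if_neg (show ¬ i + 1 < l by omega), hp] at h
  split_ifs at h ⊢ with h₁ h₂ <;>
  · rw [← Option.some.inj h]
    funext p q
    simp only [moveUp, incr, decr]
    grind

end PolyF

section Tracks

variable {n i m : ℕ} {a a' : ℕ → ℕ → ℕ}

/-- The value of an operator on the polytope is the pattern `a`, unless it is `0`. -/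
def Tracks (o : Option (Polytope n i m)) (a : ℕ → ℕ → ℕ) : Prop := ∀ P, o = some P → P.1 = a

theorem Tracks.bind_f {o : Option (Polytope n i m)} (h : Tracks o a) {l : ℕ}
    (H : ∀ b, polyF n i m l a = some b → b = a') :
    Tracks (o.bind ((polytopeCrystal n i m).f l)) a' := by
  intro P hP
  obtain ⟨Q, hQ, hQP⟩ := Option.bind_eq_some_iff.1 hP
  have := of_induced_eq_some hQP
  rw [h Q hQ] at this
  exact H _ this

theorem Tracks.congr {o : Option (Polytope n i m)} (h : Tracks o a) (e : a = a') : Tracks o a' :=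
  e ▸ h

/-- If `a_{l,n} = 0`, then `f_l` first moves all of `a_{l+1,n-1}` to row `l`, and then units of
`a_{l+1,n}`. -/
theorem Tracks.powOp_moveUp (hn : 2 ≤ n) {o : Option (Polytope n (n - 1) m)} (h : Tracks o a)
    {l : ℕ} (hl : 1 ≤ l) (hln : l < n - 1) {s : ℕ} (h0 : a l n = 0)
    (hs : a (l + 1) (n - 1) = s) (t : ℕ) :
    Tracks (powOp ((polytopeCrystal n (n - 1) m).f l) (s + t) o) (moveUp n l s t a) := by
  have h₁ : ∀ r ≤ s,
      Tracks (powOp ((polytopeCrystal n (n - 1) m).f l) r o) (moveUp n l r 0 a) := by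
    intro r hr
    induction r with
    | zero =>
      refine h.congr ?_
      funext p q
      simp [moveUp]
    | succ r ih =>
      rw [powOp_succ]
      refine (ih (by omega)).bind_f fun b hb => ?_
      rw [eq_of_polyF_lt hn hl hln hb, if_neg]
      · funext p q
        simp only [moveUp]
        grind
      · simp only [moveUp]
        grind
  rw [powOp_add]
  induction t with
  | zero => exact h₁ s le_rfl
  | succ t ih =>
    rw [powOp_succ]
    refine ih.bind_f fun b hb => ?_
    rw [eq_of_polyF_lt hn hl hln hb, if_pos]
    · funext p q
      simp only [moveUp]
      grind
    · simp only [moveUp]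
      grind

theorem Tracks.powOp_pred (hn : 2 ≤ n) {o : Option (Polytope n (n - 1) m)} (h : Tracks o a)
    (t : ℕ) : Tracks (powOp ((polytopeCrystal n (n - 1) m).f (n - 1)) t o)
      fun p q => if p = n - 1 ∧ q = n - 1 then a p q + t else a p q := by
  induction t with
  | zero => simpa [powOp_zero] using h
  | succ t ih =>
    rw [powOp_succ]
    refine ih.bind_f fun b hb => ?_
    rw [eq_of_polyF_pred hn hb]
    funext p q
    simp only [incr]
    grind

/-- The pattern made of the first `k-1` rows of `a` and the sum of the remaining entries of column
`n` in row `n-1`: the value of `Y(i)_{k-1} ⋯ Y(i)_1 H(i)` on the zero pattern. -/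
def partialPattern (n : ℕ) (a : ℕ → ℕ → ℕ) (k : ℕ) : ℕ → ℕ → ℕ := fun p q =>
  if p < k then a p q
  else if p = n - 1 ∧ q = n then ∑ j ∈ Icc k (n - 1), a j n else 0

/-- The intermediate pattern between `partialPattern n a k` and `partialPattern n a (k + 1)` in which
row `k` of `a` has been moved up to row `l`. -/
def sweepPattern (n : ℕ) (a : ℕ → ℕ → ℕ) (k l : ℕ) : ℕ → ℕ → ℕ := fun p q =>
  if p < k then a p q
  else (if p = l then a k q else 0)
    + if p = n - 1 ∧ q = n then ∑ j ∈ Icc (k + 1) (n - 1), a j n else 0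

/-- `H(i)` adds its exponent to `a_{n-1,n-1}` and then moves it on to `a_{n-1,n}`. -/
theorem tracks_opH (hn : 2 ≤ n) (h0 : ∀ q, a 0 q = 0) {o : Option (Polytope n (n - 1) m)}
    (h : Tracks o fun _ _ => 0) :
    Tracks (prodOp (polytopeCrystal n (n - 1) m).f (opH n (n - 1) a) o)
      (partialPattern n a 1) := by
  rw [opH_eq hn, prodOp_cons, prodOp_cons, prodOp_nil]
  have key : ∀ s t c, s + t = c →
      Tracks (powOp ((polytopeCrystal n (n - 1) m).f n) t
        (powOp ((polytopeCrystal n (n - 1) m).f (n - 1)) c o))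
        fun p q => if p = n - 1 then if q = n - 1 then s else if q = n then t else 0 else 0 := by
    intro s t c hc
    induction t generalizing s with
    | zero =>
      refine (h.powOp_pred hn c).congr ?_
      funext p q
      grind
    | succ t ih =>
      rw [powOp_succ]
      refine (ih (s + 1) (by omega)).bind_f fun b hb => ?_
      rw [eq_of_polyF_self hn hb (fun p q hp => if_neg hp) (by simp)]
      funext p q
      simp only [incr, decr]
      grind
  refine (key 0 _ _ (Nat.zero_add _)).congr ?_
  funext p q
  simp only [partialPattern]
  have := h0 q
  grind

/-- `Y(i)_k` adds `a_{k,n-1}` in the last row and then moves this entry, together with `a_{k,n}`, up to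
row `k`. -/
theorem tracks_opY (hn : 2 ≤ n) (hsupp : ∀ p q, q ≠ n - 1 → q ≠ n → a p q = 0)
    {o : Option (Polytope n (n - 1) m)} {k : ℕ} (hk : 1 ≤ k) (hkn : k < n)
    (h : Tracks o (partialPattern n a k)) :
    Tracks (prodOp (polytopeCrystal n (n - 1) m).f (opY n (n - 1) a k) o)
      (partialPattern n a (k + 1)) := by
  have hsum : ∑ j ∈ Icc k (n - 1), a j n = a k n + ∑ j ∈ Icc (k + 1) (n - 1), a j n := by
    rw [← add_sum_Ioc_eq_sum_Icc (show k ≤ n - 1 by omega), Icc_add_one_left_eq_Ioc]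
  rw [opY_eq hn, prodOp_append, prodOp_cons, prodOp_nil]
  have h₁ : Tracks (powOp ((polytopeCrystal n (n - 1) m).f (n - 1)) (a k (n - 1)) o)
      (sweepPattern n a k (n - 1)) := by
    refine (h.powOp_pred hn _).congr ?_
    funext p q
    have := hsupp k q
    simp only [partialPattern, sweepPattern]
    grind
  have h₂ : ∀ l, l ≤ n - 1 → k ≤ l →
      Tracks (prodOp (polytopeCrystal n (n - 1) m).f
        ((List.Ico l (n - 1)).map fun j => (j, a k (n - 1) + a k n))
        (powOp ((polytopeCrystal n (n - 1) m).f (n - 1)) (a k (n - 1)) o))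
        (sweepPattern n a k l) := by
    intro l hl
    induction hl using Nat.decreasingInduction with
    | self =>
      intro _
      rw [List.Ico.eq_nil_of_le le_rfl]
      exact h₁
    | of_succ l hl ih =>
      intro hkl
      rw [List.Ico.eq_cons hl, List.map_cons, prodOp_cons]
      refine ((ih (by omega)).powOp_moveUp hn (by omega) hl ?_ ?_ (a k n)).congr ?_
      · simp only [sweepPattern]
        grind
      · simp only [sweepPattern]
        grind
      · funext p q
        have := hsupp k q
        simp only [moveUp, sweepPattern]
        grind
  refine (h₂ k (by omega) le_rfl).congr ?_
  funext p q
  have : k = n - 1 → ∑ j ∈ Icc (k + 1) (n - 1), a j n = 0 := by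
    rintro rfl
    simp
  simp only [sweepPattern, partialPattern]
  grind

end Tracks

/-! ### The isomorphism -/

section Iso

variable {n m : ℕ}

/-- The zero pattern. -/
def zeroPattern (n i m : ℕ) : Polytope n i m := ⟨fun _ _ => 0, fun _ _ _ => rfl, fun _ _ => by simp⟩

/-- The analogue of `tableauSeq` in the polytope model. -/
noncomputable def polytopeSeq (n m : ℕ) (a : ℕ → ℕ → ℕ) : ℕ → Option (Polytope n (n - 1) m)
  | 0 => prodOp (polytopeCrystal n (n - 1) m).f (opH n (n - 1) a) (some (zeroPattern n (n - 1) m))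
  | k + 1 => prodOp (polytopeCrystal n (n - 1) m).f (opY n (n - 1) a (k + 1)) (polytopeSeq n m a k)

theorem tracks_polytopeSeq (hn : 2 ≤ n) {a : ℕ → ℕ → ℕ} (hA : IsPolytopePoint n (n - 1) m a) :
    Tracks (polytopeSeq n m a (n - 1)) a := by
  have key : ∀ k < n, Tracks (polytopeSeq n m a k) (partialPattern n a (k + 1)) := by
    intro k hk
    induction k with
    | zero =>
      refine tracks_opH hn (fun q => hA.support 0 q (by omega)) ?_
      rintro P hP
      rw [← Option.some.inj hP]
      rfl
    | succ k ih =>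
      exact tracks_opY hn (fun p q h₁ h₂ => hA.support p q (by omega)) (by omega) hk
        (ih (by omega))
  refine (key (n - 1) (by omega)).congr ?_
  funext p q
  rw [partialPattern]
  split_ifs with h₁ h₂
  · rfl
  · omega
  · exact (hA.support p q (by omega)).symm

theorem tableauSeq_eq_map_polytopeSeq (hn : 2 ≤ n) (a : ℕ → ℕ → ℕ)
    {φ : Polytope n (n - 1) m ≃ Tableau n (n - 1) m}
    (hφ : IsAffineCrystalIso n (polytopeCrystal n (n - 1) m) (tableauCrystal n (n - 1) m) φ)
    (hφ₀ : φ (zeroPattern n (n - 1) m) = highestTableau n (n - 1) m (Nat.sub_le n 1))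
    {k : ℕ} (hk : k < n) :
    tableauSeq n (n - 1) m (Nat.sub_le n 1) a k = (polytopeSeq n m a k).map φ := by
  induction k with
  | zero =>
    rw [tableauSeq, polytopeSeq, ← prodOp_map, Option.map_some, hφ₀]
    intro ja hja x
    refine hφ.map_f _ ?_ x
    simp only [opH_eq hn, List.mem_cons, List.not_mem_nil, or_false] at hja
    rcases hja with rfl | rfl <;> simp
  | succ k ih =>
    rw [tableauSeq, polytopeSeq, ih (by omega), prodOp_map]
    intro ja hja x
    refine hφ.map_f _ ?_ x
    simp only [opY_eq hn, List.mem_append, List.mem_map, List.Ico.mem, List.mem_cons,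
      List.not_mem_nil, or_false] at hja
    rcases hja with ⟨j, hj, rfl⟩ | rfl
    · change j ≤ n
      omega
    · simp

theorem add_le_entry {i : ℕ} (T : Tableau n i m) {r d c : ℕ} (hd : r + d < i) (hc : c < m) :
    T.1 r c + d ≤ T.1 (r + d) c := by
  induction d with
  | zero => simp
  | succ d ih =>
    have h₁ := ih (by omega)
    have h₂ := T.1.col_strict (show r + d < r + (d + 1) by omega) (mem_rect.2 ⟨hd, hc⟩)
    omega

theorem length_readingWord (i m : ℕ) (F : ℕ → ℕ → ℕ) : (readingWord i m F).length = i * m := by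
  simp [readingWord, List.length_flatMap]

/-- The tableau `T^{(0)}` is the only one of its weight. -/
theorem eq_highestTableau (hn : 2 ≤ n) {T : Tableau n (n - 1) m}
    (hT : ∀ l, 1 ≤ l → l ≤ n →
      (T.word.count l : ℤ) - T.word.count (l + 1) = if l = n - 1 then (m : ℤ) else 0) :
    T = highestTableau n (n - 1) m (Nat.sub_le n 1) := by
  have hmem : ∀ a, a ∈ T.word ↔ ∃ r < n - 1, ∃ c < m, T.1 r c = a := by
    intro a
    simp [Tableau.word, readingWord]
  have hN : T.word.count n = T.word.count (n + 1) := by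
    have := hT n (by omega) le_rfl
    rw [if_neg (by omega)] at this
    omega
  have hlow : ∀ l, l ≤ n - 1 → 1 ≤ l → T.word.count l = T.word.count (n + 1) + m := by
    intro l hl
    induction hl using Nat.decreasingInduction with
    | self =>
      intro h
      have := hT (n - 1) h (by omega)
      rw [if_pos rfl, Nat.sub_add_cancel (by omega)] at this
      omega
    | of_succ l hl ih =>
      intro h
      have := hT l h (by omega)
      rw [if_neg (by omega), ih (by omega)] at this
      omega
  have hsum : ∑ l ∈ Icc 1 (n + 1), T.word.count l = (n - 1) * m := by
    rw [← length_readingWord (n - 1) m T.1]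
    change _ = T.word.length
    have := Multiset.sum_count_eq_card (s := Icc 1 (n + 1)) (m := (T.word : Multiset ℕ))
      fun a ha => by
        obtain ⟨r, hr, c, hc, rfl⟩ := (hmem a).1 (Multiset.mem_coe.1 ha)
        exact mem_Icc.2 (T.2 r hr c hc)
    simpa only [Multiset.coe_count, Multiset.coe_card] using this
  -- The letters `1, …, n-1` occur `K + m` times and `n`, `n+1` occur `K` times, in a word of length
  -- `(n-1) m`; hence `K = 0`.
  have hzero : T.word.count (n + 1) = 0 := by
    obtain ⟨i, rfl⟩ := Nat.exists_eq_add_of_le' (show 1 ≤ n by omega)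
    rw [sum_Icc_succ_top (by omega), sum_Icc_succ_top (by omega), hN,
      sum_congr (s₁ := Icc 1 i) rfl fun l hl => hlow l (mem_Icc.1 hl).2 (mem_Icc.1 hl).1] at hsum
    simp only [sum_const, Nat.card_Icc, smul_eq_mul, Nat.add_sub_cancel, Nat.mul_add] at hsum
    omega
  have hle : ∀ r < n - 1, ∀ c < m, T.1 r c ≤ n - 1 := by
    intro r hr c hc
    have h₁ := (T.2 r hr c hc).2
    have h₂ : T.1 r c ∈ T.word := (hmem _).2 ⟨r, hr, c, hc, rfl⟩
    have h₃ : T.1 r c ≠ n + 1 := by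
      intro e
      rw [e] at h₂
      exact List.count_eq_zero.1 hzero h₂
    have h₄ : T.1 r c ≠ n := by
      intro e
      rw [e] at h₂
      exact List.count_eq_zero.1 (hN.trans hzero) h₂
    omega
  refine Subtype.ext (SemistandardYoungTableau.ext fun r c => ?_)
  change T.1 r c = if r < n - 1 ∧ c < m then r + 1 else 0
  split_ifs with hrc
  · have h₁ := add_le_entry T (r := 0) (d := r) (by omega) hrc.2
    have h₂ := add_le_entry T (r := r) (d := n - 2 - r) (by omega) hrc.2
    have h₃ := (T.2 0 (by omega) c hrc.2).1
    have h₄ := hle (r + (n - 2 - r)) (by omega) c hrc.2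
    rw [Nat.zero_add] at h₁
    omega
  · exact T.1.zeros fun h => hrc (mem_rect.1 h)

/-- An isomorphism preserves weights, so it sends the zero pattern to the highest weight tableau. -/
theorem map_zeroPattern (hn : 2 ≤ n) {φ : Polytope n (n - 1) m ≃ Tableau n (n - 1) m}
    (hφ : IsAffineCrystalIso n (polytopeCrystal n (n - 1) m) (tableauCrystal n (n - 1) m) φ) :
    φ (zeroPattern n (n - 1) m) = highestTableau n (n - 1) m (Nat.sub_le n 1) := by
  refine eq_highestTableau hn fun l hl hln => ?_
  have h := hφ.map_wt l hln (zeroPattern n (n - 1) m)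
  simp only [tableauCrystal, polytopeCrystal, levelZero, if_neg (show l ≠ 0 by omega)] at h
  rw [h, polyWt]
  simp [zeroPattern]

end Iso
end KRCrystal

open KRCrystal
theorem theorem4p5 (n m : ℕ) (hn : 2 ≤ n) (hm : 1 ≤ m) (A : Polytope n (n - 1) m)
    (a : ℕ → ℕ → ℤ) (ha : ∀ p q, a p q = (A.1 p q : ℤ))
    (Ω ν : ℕ → ℤ) (hΩ : Ω = Omega n A.1) (hν : ν = nu n A.1) :
    (∀ k, 1 ≤ k → k < n →
      ∃ T : Tableau n (n - 1) m,
        tableauSeq n (n - 1) m (Nat.sub_le n 1) A.1 k = some T ∧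
        (∀ s, 1 ≤ s → s ≤ k - 1 →
          T.rowTriple s =
            (m - ∑ j ∈ Icc 1 s, (a j n - ν j * Ω j),
             -(∑ j ∈ Icc 1 s, ν j * Ω j) + (1 - ν (s + 1)) * Ω (s + 1),
             ∑ j ∈ Icc 2 (s + 1), (a j (n - 1) + ν j * Ω j))) ∧
        (∀ s, k ≤ s → s ≤ n - 1 - 1 →
          T.rowTriple s =
            (m - ∑ j ∈ Icc 1 k, (a j n - ν j * Ω j),
             -(∑ j ∈ Icc 1 k, ν j * Ω j) + a k n + (1 - ν k) * Ω k,
             ∑ j ∈ Icc 2 k, (a j (n - 1) + ν j * Ω j))) ∧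
        T.rowTriple (n - 1) =
          (m - (∑ j ∈ Icc 1 (n - 1), a j n) + ∑ j ∈ Icc 1 k, ν j * Ω j,
           -(∑ j ∈ Icc 1 k, ν j * Ω j),
           ∑ j ∈ Icc 1 (n - 1), a j n)) ∧
    ∀ φ : Polytope n (n - 1) m ≃ Tableau n (n - 1) m,
      IsAffineCrystalIso n (polytopeCrystal n (n - 1) m) (tableauCrystal n (n - 1) m) φ →
        tableauSeq n (n - 1) m (Nat.sub_le n 1) A.1 (n - 1) = some (φ A) := by
  subst hΩ hν
  obtain rfl : a = fun p q => (A.1 p q : ℤ) := funext fun p => funext fun q => ha p q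
  refine ⟨fun k hk hkn => ?_, fun φ hφ => ?_⟩
  · obtain ⟨x, y, ⟨h, hT⟩, hx, hy, hxn, hyn⟩ := exists_reaches_tableauSeq hn A.2 hkn
    -- The first summand of the third entry vanishes.
    have hthird : ∀ l, 1 ≤ l →
        ∑ j ∈ Icc 1 l, ((A.1 j (n - 1) : ℤ) + nu n A.1 j * Omega n A.1 j) =
          ∑ j ∈ Icc 2 l, ((A.1 j (n - 1) : ℤ) + nu n A.1 j * Omega n A.1 j) := by
      intro l hl
      rw [← add_sum_Ioc_eq_sum_Icc hl, nu_one, Omega_one, one_mul, add_neg_cancel, zero_add]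
      rfl
    refine ⟨_, hT, fun s hs hsk => ?_, fun s hks hs => ?_, ?_⟩
    · have h₁ := hx s (by omega)
      have h₂ := hy s (by omega)
      have ht := sum_nu_mul_Omega n A.1 s
      rw [min_eq_left (by omega)] at h₁ h₂
      rw [rowTriple_profileTableau h hs (by omega), ← hthird (s + 1) (by omega), h₁, h₂]
      refine Prod.ext rfl (Prod.ext ?_ (by ring))
      rw [sum_Icc_succ_top (by omega) (fun j => nu n A.1 j * Omega n A.1 j)] at ht
      dsimp only
      rw [sum_sub_distrib, sum_add_distrib,
        sum_Icc_succ_top (by omega) (fun j => nu n A.1 j * Omega n A.1 j)]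
      linarith
    · have h₁ := hx s (by omega)
      have h₂ := hy s (by omega)
      rw [min_eq_right (by omega)] at h₁ h₂
      rw [rowTriple_profileTableau h (by omega) (by omega), ← hthird k hk, h₁, h₂]
      refine Prod.ext rfl (Prod.ext ?_ (by ring))
      obtain ⟨k, rfl⟩ := Nat.exists_eq_add_of_le' hk
      have ht := sum_nu_mul_Omega n A.1 k
      dsimp only
      rw [sum_sub_distrib, sum_add_distrib,
        sum_Icc_succ_top (by omega) (fun j => (A.1 j n : ℤ))]
      linarith
    · rw [rowTriple_profileTableau h (by omega) (by omega), hxn, hyn]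
      exact Prod.ext rfl (Prod.ext (by ring) (by ring))
  · obtain ⟨x, y, ⟨h, hT⟩, -⟩ := exists_reaches_tableauSeq hn A.2 (show n - 1 < n by omega)
    have hmap := tableauSeq_eq_map_polytopeSeq hn A.1 hφ (map_zeroPattern hn hφ)
      (show n - 1 < n by omega)
    -- The tableau is not `0`, and hence neither is the pattern.
    obtain ⟨P, hP, -⟩ := Option.map_eq_some_iff.1 (hmap.symm.trans hT)
    rw [hmap, hP, Option.map_some, Subtype.ext (tracks_polytopeSeq hn A.2 P hP)]
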